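/- **Setting.** Let $A$ and $B$ be quantum systems with finite-dimensional Hilbert spaces. A vector $|\psi\rangle$ of $AB$ has a Schmidt decomposition $|\psi\rangle=\sum_s\lambda_s|\psi_{A,s}\rangle\otimes|\psi_{B,s}\rangle$ with $\lambda_s\ge 0$; its Schmidt rank is the number of nonzero $\lambda_s$. Put $E_\infty(\psi)=-\log\max_s\lambda_s^2$ and $E_1(\psi)=-\sum_s\lambda_s^2\log\lambda_s^2$ (the entanglement entropy). For an operator $\Phi$ on $AB$, the spectral-entangling strength $\bar{\mathcal J}(\Phi)$ is the supremum, over all finite-dimensional ancillas $A',B'$ and all unit vectors $|\phi\rangle$ of $AA'$ and $|\chi\rangle$ of $BB'$, of the sum of the Schmidt coefficients across $AA'|BB'$ of $(\Phi\otimes 1_{A'B'})\,|\phi\rangle\otimes|\chi\rangle$. **Boundary-adiabatic path.** Let $\Delta>0$, $\tilde g>0$ and $\tilde c_0$ be real numbers. For $\nu\in[0,1]$ let $$H^{(\nu)}=H_A+V^{(\nu)}_{AB}+H_B$$ with Hermitian operators $H_A$ on $A$, $H_B$ on $B$ and $V^{(\nu)}_{AB}$ on $AB$, where $\nu\mapsto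 V^{(\nu)}_{AB}$ is twice differentiable on $[0,1]$ (one-sidedly at the end points). Assume that for every $\nu\in[0,1]$: (i) $\bar{\mathcal J}(V^{(\nu)}_{AB})\le\tilde g$; (ii) $H^{(\nu)}$ has a non-degenerate ground state, with unit vector $|\Omega^{(\nu)}\rangle$, and every other eigenvalue exceeds the ground energy by at least $\Delta$; (iii) $\max\big(\|dV^{(\nu)}_{AB}/d\nu\|,\ \|d^2V^{(\nu)}_{AB}/d\nu^2\|\big)\le\tilde c_0\tilde g$ in operator norm. **Theorem.** Let $S_0=E_\infty(\Omega^{(0)})$ and $$\kappa_\Delta=\frac{\Delta}{2\Delta+4\tilde g},\qquad C_{\tilde g,\Delta,S_0}=\exp\!\left[\frac{S_0+3}{4\kappa_\Delta}+\log 12+\frac{3\tilde c_0\tilde g^3(2\Delta/\tilde g+7\tilde c_0)}{\Delta^3}\right].$$ Then for every integer $D\ge 1$ there is a normalized state $|\psi_D\rangle$ of Schmidt rank at most $D$ with $$\big\|\,|\psi_D\rangle-|\Omega^{(1)}\rangle\,\big\|\le C_{\tilde g,\Delta,S_0}\,D^{-\kappa_\Delta}.$$ Moreover $$E_1(\Omega^{(1)})\le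 c_{\kappa_\Delta,1}\log C_{\tilde g,\Delta,S_0}+c_{\kappa_\Delta,2},\qquad c_{\kappa,1}=\frac{2-2^{-2\kappa}}{\kappa(1-2^{-2\kappa})},\quad c_{\kappa,2}=\frac{(6+2\kappa)\log 2}{(1-2^{-2\kappa})^2}.$$ -/

import Mathlib

open scoped ENNReal ComplexOrder Kronecker Matrix Matrix.Norms.L2Operator

namespace AreaLaw

/-! Pure states of a bipartite system with finite-dimensional parts `A` and `B`, written in
orthonormal product bases indexed by `a` and `b`, are vectors of `EuclideanSpace ℂ (a × b)`.
Operators are complex matrices, and their norm is the operator norm on `ℓ²`. -/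

/-- The coefficient matrix `M i j = ⟨i, j | ψ⟩` of a bipartite vector. -/
def coeffMatrix {a b : Type*} (ψ : EuclideanSpace ℂ (a × b)) : Matrix a b ℂ :=
  Matrix.of fun i j => ψ (i, j)

/-- The reduced density matrix `ρ_A = tr_B |ψ⟩⟨ψ|`, in terms of the coefficient matrix. -/
def reducedDensity {a b : Type*} [Fintype b] (ψ : EuclideanSpace ℂ (a × b)) : Matrix a a ℂ :=
  coeffMatrix ψ * (coeffMatrix ψ)ᴴ

theorem reducedDensity_isHermitian {a b : Type*} [Fintype b] (ψ : EuclideanSpace ℂ (a × b)) :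
    (reducedDensity ψ).IsHermitian :=
  Matrix.isHermitian_mul_conjTranspose_self _

/-- The Schmidt coefficients `λ_s ≥ 0` of `ψ`: the square roots of the eigenvalues of `ρ_A`,
listed with multiplicity and padded with zeros up to the dimension of `A`. -/
noncomputable def schmidtCoeff {a b : Type*} [Fintype a] [DecidableEq a] [Fintype b]
    (ψ : EuclideanSpace ℂ (a × b)) (s : a) : ℝ :=
  √((reducedDensity_isHermitian ψ).eigenvalues s)

/-- The Schmidt rank: the number of nonzero Schmidt coefficients. -/
noncomputable def schmidtRank {a b : Type*} [Fintype a] [DecidableEq a] [Fintype b]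
    (ψ : EuclideanSpace ℂ (a × b)) : ℕ :=
  Nat.card {s : a // schmidtCoeff ψ s ≠ 0}

theorem schmidtRank_eq_rank {a b : Type*} [Fintype a] [DecidableEq a] [Fintype b]
    (ψ : EuclideanSpace ℂ (a × b)) : schmidtRank ψ = (coeffMatrix ψ).rank := by
  have hpos : (reducedDensity ψ).PosSemidef := Matrix.posSemidef_self_mul_conjTranspose _
  have h := (reducedDensity_isHermitian ψ).rank_eq_card_non_zero_eigs
  rw [← Matrix.rank_self_mul_conjTranspose, ← reducedDensity, h, schmidtRank,
    ← Nat.card_eq_fintype_card]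
  refine Nat.card_congr (Equiv.subtypeEquivRight fun s => ?_)
  rw [schmidtCoeff, Real.sqrt_ne_zero (hpos.eigenvalues_nonneg s)]

/-- The entanglement entropy `E_1(ψ) = -∑ λ_s² log λ_s²`. -/
noncomputable def entanglementEntropy {a b : Type*} [Fintype a] [DecidableEq a] [Fintype b]
    (ψ : EuclideanSpace ℂ (a × b)) : ℝ :=
  -∑ s, schmidtCoeff ψ s ^ 2 * Real.log (schmidtCoeff ψ s ^ 2)

/-- The `∞`-Rényi entanglement `E_∞(ψ) = -log (max_s λ_s²)`. -/
noncomputable def renyiInfEntropy {a b : Type*} [Fintype a] [DecidableEq a] [Fintype b]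
    (ψ : EuclideanSpace ℂ (a × b)) : ℝ :=
  -Real.log (⨆ s, schmidtCoeff ψ s ^ 2)

/-- The product vector `φ ⊗ χ`. -/
noncomputable def productState {a b : Type*} (φ : EuclideanSpace ℂ a) (χ : EuclideanSpace ℂ b) :
    EuclideanSpace ℂ (a × b) :=
  WithLp.toLp 2 fun p => φ p.1 * χ p.2

/-- The operator `Φ ⊗ 1` obtained by attaching ancillas `A'` and `B'` (of dimensions `n`, `m`)
to `A` and `B`, as an operator on the bipartite system `AA' | BB'`. -/
def withAncilla {a b : Type*} (Φ : Matrix (a × b) (a × b) ℂ) (n m : ℕ) :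
    Matrix ((a × Fin n) × (b × Fin m)) ((a × Fin n) × (b × Fin m)) ℂ :=
  (Φ ⊗ₖ (1 : Matrix (Fin n × Fin m) (Fin n × Fin m) ℂ)).submatrix
    (Equiv.prodProdProdComm a (Fin n) b (Fin m)) (Equiv.prodProdProdComm a (Fin n) b (Fin m))

/-- The spectral-entangling strength of `Φ`: the supremum of `∑ λ_s`, where `λ_s` are the Schmidt
coefficients across `AA' | BB'` of `Φ (φ ⊗ χ)`, over all finite-dimensional ancillas `A'`, `B'`
and all unit vectors `φ` of `AA'` and `χ` of `BB'`. -/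
noncomputable def seStrength {a b : Type*} [Fintype a] [DecidableEq a] [Fintype b] [DecidableEq b]
    (Φ : Matrix (a × b) (a × b) ℂ) : ℝ≥0∞ :=
  ⨆ (n : ℕ) (m : ℕ) (φ : EuclideanSpace ℂ (a × Fin n)) (χ : EuclideanSpace ℂ (b × Fin m))
    (_ : ‖φ‖ = 1) (_ : ‖χ‖ = 1),
    ENNReal.ofReal
      (∑ s, schmidtCoeff (Matrix.toEuclideanLin (withAncilla Φ n m) (productState φ χ)) s)

/-- The Hamiltonian `H_A + V_AB + H_B`. -/
def hamiltonian {a b : Type*} [DecidableEq a] [DecidableEq b]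
    (HA : Matrix a a ℂ) (HB : Matrix b b ℂ) (V : Matrix (a × b) (a × b) ℂ) :
    Matrix (a × b) (a × b) ℂ :=
  HA ⊗ₖ (1 : Matrix b b ℂ) + V + (1 : Matrix a a ℂ) ⊗ₖ HB

/-- `Ω` is a normalized ground state of `H` with energy `E₀`, and the ground state is
non-degenerate. -/
structure IsNondegenerateGroundState {ι : Type*} [Fintype ι] [DecidableEq ι]
    (H : Matrix ι ι ℂ) (E₀ : ℝ) (Ω : EuclideanSpace ℂ ι) : Prop where
  norm_eq_one : ‖Ω‖ = 1
  eigenvector : Matrix.toEuclideanLin H Ω = (E₀ : ℂ) • Ω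
  minimal : ∀ E : ℝ, Module.End.HasEigenvalue (Matrix.toEuclideanLin H) (E : ℂ) → E₀ ≤ E
  nondegenerate : ∀ φ : EuclideanSpace ℂ ι,
    Matrix.toEuclideanLin H φ = (E₀ : ℂ) • φ → ∃ c : ℂ, φ = c • Ω

/-- The gap above the ground energy `E₀` of `H` is at least `Δ`: every excited energy is at least
`E₀ + Δ`. -/
def SpectralGapGE {ι : Type*} [Fintype ι] [DecidableEq ι]
    (H : Matrix ι ι ℂ) (E₀ Δ : ℝ) : Prop :=
  ∀ E : ℝ, Module.End.HasEigenvalue (Matrix.toEuclideanLin H) (E : ℂ) → E ≠ E₀ → Δ ≤ E - E₀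

/-- A boundary-adiabatic path `H^(ν) = H_A + V^(ν) + H_B`, `ν ∈ [0,1]`, with ground states
`Ω^(ν)`, gap at least `Δ`, spectral-entangling strength of `V^(ν)` at most `g`, and first and
second derivatives of `V^(ν)` (one-sided at the end points) of operator norm at most `c₀ g`. -/
structure IsBoundaryAdiabaticPath {a b : Type*} [Fintype a] [DecidableEq a] [Fintype b]
    [DecidableEq b] (HA : Matrix a a ℂ) (HB : Matrix b b ℂ) (V : ℝ → Matrix (a × b) (a × b) ℂ)
    (Ω : ℝ → EuclideanSpace ℂ (a × b)) (Δ g c₀ : ℝ) : Prop where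
  hermitian_A : HA.IsHermitian
  hermitian_B : HB.IsHermitian
  hermitian_V : ∀ ν ∈ Set.Icc (0 : ℝ) 1, (V ν).IsHermitian
  seStrength_le : ∀ ν ∈ Set.Icc (0 : ℝ) 1, seStrength (V ν) ≤ ENNReal.ofReal g
  gapped : ∀ ν ∈ Set.Icc (0 : ℝ) 1, ∃ E₀ : ℝ,
    IsNondegenerateGroundState (hamiltonian HA HB (V ν)) E₀ (Ω ν) ∧
      SpectralGapGE (hamiltonian HA HB (V ν)) E₀ Δ
  differentiable : DifferentiableOn ℝ V (Set.Icc 0 1)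
  differentiable_deriv : DifferentiableOn ℝ (derivWithin V (Set.Icc 0 1)) (Set.Icc 0 1)
  deriv_le : ∀ ν ∈ Set.Icc (0 : ℝ) 1,
    max ‖derivWithin V (Set.Icc 0 1) ν‖
      ‖derivWithin (derivWithin V (Set.Icc 0 1)) (Set.Icc 0 1) ν‖ ≤ c₀ * g

/-- The exponent `κ_Δ = Δ / (2Δ + 4g)`. -/
noncomputable def kappa (Δ g : ℝ) : ℝ := Δ / (2 * Δ + 4 * g)

/-- The prefactor `C_{g,Δ,S₀}`. -/
noncomputable def errorConst (Δ g c₀ S₀ : ℝ) : ℝ :=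
  Real.exp ((S₀ + 3) / (4 * kappa Δ g) + Real.log 12 +
    3 * c₀ * g ^ 3 * (2 * Δ / g + 7 * c₀) / Δ ^ 3)

/-- The coefficient `c_{κ,1}`. -/
noncomputable def entropyConst₁ (κ : ℝ) : ℝ :=
  (2 - (2 : ℝ) ^ (-2 * κ)) / (κ * (1 - (2 : ℝ) ^ (-2 * κ)))

/-- The coefficient `c_{κ,2}`. -/
noncomputable def entropyConst₂ (κ : ℝ) : ℝ :=
  (6 + 2 * κ) * Real.log 2 / (1 - (2 : ℝ) ^ (-2 * κ)) ^ 2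

end AreaLaw

/-!
The proof replaces adiabatic time evolution by a finite sequence of approximate ground state
projections along the path, and measures entanglement by the projective norm `productNorm`, the
gauge of the convex hull of the product vectors with factors of norm at most one.

Three properties of this norm carry the argument. A vector of norm less than `J` is within `J / √D`
of a vector of Schmidt rank at most `D`, by Maurey's sparsification
(`exists_schmidtRank_le_norm_sub_le`). The Schmidt decomposition bounds the norm by the sum of the
Schmidt coefficients, so an operator of spectral-entangling strength `g` increases it at most
`g`-fold (`productNorm_le_of_seStrength_le`). And to first order in time only the interaction
increases it, so that evolution for a time `t` costs a factor of at most `e^{g |t|}`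
(`productNorm_evolution_le`).

Averaging the time evolution against a truncated binomial distribution of times in `[-T, T]`
therefore gives an operator that fixes the ground state, suppresses its complement by
`5 e^{-TΔ/2}`, and costs a factor `e^{g T}` (`exists_approx_groundState_projection`).

Set `x = c₀ g / Δ`. The product vector with the largest overlap with `Ω 0` is projected for a time
`(S₀ + 6) / Δ`, and the ground state is then followed in `N = ⌈x + 7 x² / 2⌉ + 1` equal steps, each
but the last of which is followed by a projection for a time `6 / Δ`. Consecutive ground states
form an angle of sine at most `x / (N - x)` (`norm_rest_groundState_le`). If `A` is the amplitude
along the current ground state and `W` the norm of the remainder, then `A² - W²` loses only a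
fraction of second order in that angle per step (`amplitude_step`), as in the quantum Zeno effect,
so the total loss is bounded by a constant (`IsBoundaryAdiabaticPath.exists_final`). A last
projection at `ν = 1`, for a time that balances its error against that of the truncation to Schmidt
rank `D`, yields the exponent `κ_Δ` (`IsBoundaryAdiabaticPath.exists_schmidtRank_le`).

For the entropy, an approximation of rank `D` with error `ε` bounds the sum of all but the `D`
largest squared Schmidt coefficients by `ε²` (`sum_schmidtCoeff_tail_le`). Gibbs' inequality against
the distribution `1 / (s (s + 1))` reduces the entropy to the mean dyadic scale of the index,
a sum of tails (`entropy_le_of_tail_le`).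
-/

namespace AreaLaw

/-! ### The projective norm of bipartite vectors -/

section ProductNorm

variable {a b : Type*}

theorem productState_apply (φ : EuclideanSpace ℂ a) (χ : EuclideanSpace ℂ b) (p : a × b) :
    productState φ χ p = φ p.1 * χ p.2 := rfl

theorem smul_productState (c : ℂ) (φ : EuclideanSpace ℂ a) (χ : EuclideanSpace ℂ b) :
    c • productState φ χ = productState (c • φ) χ := by
  ext p
  simp [productState_apply, mul_assoc]

theorem productState_smul_smul_real (c d : ℝ) (φ : EuclideanSpace ℂ a)
    (χ : EuclideanSpace ℂ b) :
    productState (c • φ) (d • χ) = (c * d) • productState φ χ := by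
  ext p
  simp [productState_apply]
  ring

variable [Fintype a] [Fintype b]

theorem norm_productState (φ : EuclideanSpace ℂ a) (χ : EuclideanSpace ℂ b) :
    ‖productState φ χ‖ = ‖φ‖ * ‖χ‖ := by
  rw [EuclideanSpace.norm_eq, EuclideanSpace.norm_eq, EuclideanSpace.norm_eq,
    ← Real.sqrt_mul (by positivity), Fintype.sum_prod_type, Finset.sum_mul_sum]
  simp [productState_apply, mul_pow]

/-- The product vectors `φ ⊗ χ` with factors of norm at most one. -/
def productBall (a b : Type*) [Fintype a] [Fintype b] : Set (EuclideanSpace ℂ (a × b)) :=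
  {ψ | ∃ φ χ, ‖φ‖ ≤ 1 ∧ ‖χ‖ ≤ 1 ∧ ψ = productState φ χ}

theorem norm_le_one_of_mem_productBall {ψ : EuclideanSpace ℂ (a × b)} (h : ψ ∈ productBall a b) :
    ‖ψ‖ ≤ 1 := by
  obtain ⟨φ, χ, hφ, hχ, rfl⟩ := h
  rw [norm_productState]
  exact mul_le_one₀ hφ (norm_nonneg _) hχ

theorem zero_mem_productBall : (0 : EuclideanSpace ℂ (a × b)) ∈ productBall a b :=
  ⟨0, 0, by simp, by simp, by ext p; simp [productState_apply]⟩

theorem smul_mem_productBall {c : ℂ} (hc : ‖c‖ ≤ 1) {ψ : EuclideanSpace ℂ (a × b)}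
    (h : ψ ∈ productBall a b) : c • ψ ∈ productBall a b := by
  obtain ⟨φ, χ, hφ, hχ, rfl⟩ := h
  refine ⟨c • φ, χ, ?_, hχ, smul_productState _ _ _⟩
  rw [norm_smul]
  exact mul_le_one₀ hc (norm_nonneg _) hφ

theorem balanced_convexHull_productBall : Balanced ℂ (convexHull ℝ (productBall a b)) := by
  intro c hc
  rintro _ ⟨x, hx, rfl⟩
  have h := (LinearMap.image_convexHull
    ((c • (LinearMap.id : EuclideanSpace ℂ (a × b) →ₗ[ℂ] _)).restrictScalars ℝ)
    (productBall a b)).le ⟨x, hx, rfl⟩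
  refine convexHull_mono ?_ h
  rintro _ ⟨y, hy, rfl⟩
  exact smul_mem_productBall hc hy

theorem ball_subset_convexHull_productBall :
    Metric.ball (0 : EuclideanSpace ℂ (a × b)) ((Fintype.card (a × b) : ℝ) + 1)⁻¹ ⊆
      convexHull ℝ (productBall a b) := by
  classical
  intro x hx
  set n := Fintype.card (a × b) with hn
  have hx' : ‖x‖ < ((n : ℝ) + 1)⁻¹ := by simpa using hx
  rcases isEmpty_or_nonempty (a × b) with h | h
  · rw [Subsingleton.elim x 0]
    exact subset_convexHull _ _ zero_mem_productBall
  have hn0 : (0 : ℝ) < n := by exact_mod_cast Fintype.card_pos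
  -- `x` is an average over the basis of product vectors of norm less than one
  have hsum : x = ∑ p : a × b, (n : ℝ)⁻¹ • ((n : ℂ) • x p •
      productState (EuclideanSpace.single p.1 (1 : ℂ)) (EuclideanSpace.single p.2 (1 : ℂ))) := by
    ext q
    have h0 : (n : ℂ) ≠ 0 := by exact_mod_cast hn0.ne'
    simp only [WithLp.ofLp_sum, Finset.sum_apply, PiLp.smul_apply, productState_apply]
    rw [Finset.sum_eq_single q]
    · simp [h0]
    · rintro p - hp
      have : q.1 ≠ p.1 ∨ q.2 ≠ p.2 := by
        by_contra! hh
        exact hp (Prod.ext hh.1.symm hh.2.symm)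
      rcases this with h | h <;> simp [h]
    · simp
  rw [hsum]
  refine (convex_convexHull ℝ _).sum_mem (fun _ _ => by positivity) ?_ ?_
  · simp [← hn, hn0.ne']
  · intro p _
    refine subset_convexHull _ _ ?_
    rw [smul_smul]
    refine smul_mem_productBall ?_ ⟨_, _, by simp, by simp, rfl⟩
    have h1 : ‖x p‖ ≤ ‖x‖ := PiLp.norm_apply_le x p
    rw [norm_mul, Complex.norm_natCast]
    have h2 : ‖x p‖ ≤ ((n : ℝ) + 1)⁻¹ := h1.trans hx'.le
    calc (n : ℝ) * ‖x p‖ ≤ n * ((n : ℝ) + 1)⁻¹ := by gcongr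
      _ ≤ 1 := by rw [← div_eq_mul_inv, div_le_one (by positivity)]; linarith

theorem absorbent_convexHull_productBall : Absorbent ℝ (convexHull ℝ (productBall a b)) :=
  (absorbent_ball_zero (by positivity)).mono ball_subset_convexHull_productBall

/-- The projective norm of a bipartite vector: the infimum of `∑ ‖φ_i‖ ‖χ_i‖` over
decompositions `ψ = ∑ φ_i ⊗ χ_i`, encoded as the gauge of the convex hull of the product
vectors with factors of norm at most one. -/
noncomputable def productNorm (a b : Type*) [Fintype a] [Fintype b] :
    Seminorm ℂ (EuclideanSpace ℂ (a × b)) :=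
  gaugeSeminorm balanced_convexHull_productBall (convex_convexHull ℝ _)
    absorbent_convexHull_productBall

theorem productNorm_apply (x : EuclideanSpace ℂ (a × b)) :
    productNorm a b x = gauge (convexHull ℝ (productBall a b)) x := rfl

theorem productNorm_sum_le {ι : Type*} (s : Finset ι) (f : ι → EuclideanSpace ℂ (a × b)) :
    productNorm a b (∑ i ∈ s, f i) ≤ ∑ i ∈ s, productNorm a b (f i) :=
  Finset.le_sum_of_subadditive _ (map_zero _).le (map_add_le_add _) s f

theorem productNorm_productState_le (φ : EuclideanSpace ℂ a) (χ : EuclideanSpace ℂ b) :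
    productNorm a b (productState φ χ) ≤ ‖φ‖ * ‖χ‖ := by
  rw [productNorm_apply]
  refine gauge_le_of_mem (by positivity) ⟨productState (‖φ‖⁻¹ • φ) (‖χ‖⁻¹ • χ),
    subset_convexHull _ _ ⟨_, _, ?_, ?_, rfl⟩, ?_⟩
  · rw [norm_smul, norm_inv, norm_norm]
    exact inv_mul_le_one_of_le₀ le_rfl (norm_nonneg _)
  · rw [norm_smul, norm_inv, norm_norm]
    exact inv_mul_le_one_of_le₀ le_rfl (norm_nonneg _)
  -- normalizing fails only for a zero factor, where both sides vanish
  · change (‖φ‖ * ‖χ‖) • productState (‖φ‖⁻¹ • φ) (‖χ‖⁻¹ • χ) = _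
    rw [← productState_smul_smul_real, smul_smul, smul_smul]
    rcases eq_or_ne φ 0 with rfl | hφ
    · ext p; simp [productState_apply]
    rcases eq_or_ne χ 0 with rfl | hχ
    · ext p; simp [productState_apply]
    rw [mul_inv_cancel₀ (norm_ne_zero_iff.mpr hφ), mul_inv_cancel₀ (norm_ne_zero_iff.mpr hχ),
      one_smul, one_smul]

theorem productNorm_le_card_mul_norm (x : EuclideanSpace ℂ (a × b)) :
    productNorm a b x ≤ ((Fintype.card (a × b) : ℝ) + 1) * ‖x‖ := by
  have h := mul_gauge_le_norm (x := x) (ball_subset_convexHull_productBall (a := a) (b := b))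
  rw [inv_mul_le_iff₀ (by positivity)] at h
  exact h

theorem norm_le_productNorm (x : EuclideanSpace ℂ (a × b)) : ‖x‖ ≤ productNorm a b x := by
  have h := le_gauge_of_subset_closedBall (s := convexHull ℝ (productBall a b)) (r := 1) (x := x)
    absorbent_convexHull_productBall zero_le_one
    (convexHull_min (fun y hy => by simpa using norm_le_one_of_mem_productBall hy)
      (convex_closedBall _ _))
  simpa [productNorm_apply] using h

/-- A linear map that takes product vectors to vectors of projective norm at most `J` increases
the projective norm of every vector at most `J`-fold. -/
theorem productNorm_map_le {K : EuclideanSpace ℂ (a × b) →ₗ[ℂ] EuclideanSpace ℂ (a × b)} {J : ℝ}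
    (hJ : 0 ≤ J) (hK : ∀ φ χ, productNorm a b (K (productState φ χ)) ≤ J * (‖φ‖ * ‖χ‖))
    (x : EuclideanSpace ℂ (a × b)) : productNorm a b (K x) ≤ J * productNorm a b x := by
  have hS : ∀ y ∈ convexHull ℝ (productBall a b), productNorm a b (K y) ≤ J := by
    have hconv : Convex ℝ {y | productNorm a b (K y) ≤ J} := by
      have h1 := (productNorm a b).convex_closedBall 0 J
      have h2 := h1.is_linear_preimage (f := fun y => K y)
        ⟨K.map_add, fun c y => (K.restrictScalars ℝ).map_smul c y⟩
      have h3 : {y | productNorm a b (K y) ≤ J} =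
          (fun y => K y) ⁻¹' (productNorm a b).closedBall 0 J := by
        ext y
        exact (Seminorm.mem_closedBall_zero (productNorm a b)).symm
      rw [h3]
      exact h2
    refine convexHull_min ?_ hconv
    rintro _ ⟨φ, χ, hφ, hχ, rfl⟩
    refine (hK φ χ).trans ?_
    have : ‖φ‖ * ‖χ‖ ≤ 1 := mul_le_one₀ hφ (norm_nonneg _) hχ
    nlinarith
  refine le_of_forall_pos_le_add fun ε hε => ?_
  have hlt : gauge (convexHull ℝ (productBall a b)) x < productNorm a b x + ε / (J + 1) := by
    rw [← productNorm_apply]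
    have : 0 < ε / (J + 1) := by positivity
    linarith
  obtain ⟨r, hr0, hr, y, hy, rfl⟩ :=
    exists_lt_of_gauge_lt absorbent_convexHull_productBall hlt
  have h3 : K (r • y) = (r : ℂ) • K y := by
    rw [← map_smul]; rfl
  change productNorm a b (K (r • y)) ≤ J * productNorm a b (r • y) + ε
  rw [h3, map_smul_eq_mul, Complex.norm_real, Real.norm_of_nonneg hr0.le]
  have h4 := hS y hy
  have h5 : J * (ε / (J + 1)) ≤ ε := by
    rw [mul_div_assoc', div_le_iff₀ (by positivity)]; nlinarith
  calc r * productNorm a b (K y) ≤ r * J := by gcongr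
    _ ≤ (productNorm a b (r • y) + ε / (J + 1)) * J := by gcongr
    _ ≤ _ := by nlinarith

/-- A vector that is a sum of `D` product vectors has Schmidt rank at most `D`. -/
theorem schmidtRank_sum_productState_le [DecidableEq a] {D : ℕ} (φ : Fin D → EuclideanSpace ℂ a)
    (χ : Fin D → EuclideanSpace ℂ b) : schmidtRank (∑ i, productState (φ i) (χ i)) ≤ D := by
  rw [schmidtRank_eq_rank]
  have h : coeffMatrix (∑ i, productState (φ i) (χ i)) =
      (Matrix.of fun (j : a) (i : Fin D) => φ i j) *
        (Matrix.of fun (i : Fin D) (j : b) => χ i j) := by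
    ext j k
    simp [coeffMatrix, Matrix.mul_apply, productState_apply]
  rw [h]
  refine (Matrix.rank_mul_le_left _ _).trans ?_
  simpa using Matrix.rank_le_card_width (Matrix.of fun (j : a) (i : Fin D) => φ i j)

theorem schmidtRank_smul_le [DecidableEq a] (c : ℂ) (ψ : EuclideanSpace ℂ (a × b)) :
    schmidtRank (c • ψ) ≤ schmidtRank ψ := by
  classical
  rw [schmidtRank_eq_rank, schmidtRank_eq_rank]
  have h : coeffMatrix (c • ψ) = (c • (1 : Matrix a a ℂ)) * coeffMatrix ψ := by
    ext i j
    simp [coeffMatrix]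
  rw [h]
  exact Matrix.rank_mul_le_right _ _

/-- One step of the greedy sparsification: a linear functional takes on `S` a value at most the
one it takes at a given point of the convex hull of `S`. -/
theorem exists_re_inner_le_of_mem_convexHull {E : Type*} [NormedAddCommGroup E]
    [InnerProductSpace ℂ E] {S : Set E} {x : E} (hx : x ∈ convexHull ℝ S) (u : E) :
    ∃ z ∈ S, (inner ℂ u z).re ≤ (inner ℂ u x).re := by
  by_contra! h
  have hconv : Convex ℝ {y | (inner ℂ u x).re < (inner ℂ u y).re} := by
    refine convex_halfSpace_gt ⟨fun y z => by simp, fun c y => ?_⟩ _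
    rw [← Complex.coe_smul, inner_smul_right, Complex.re_ofReal_mul, smul_eq_mul]
  exact lt_irrefl (inner ℂ u x).re (convexHull_min (fun z hz => h z hz) hconv hx)

/-- Maurey's sparsification: a point of the convex hull of a subset of the unit ball of a Hilbert
space is within `1 / √D` of an average of `D` points of that set. -/
theorem exists_norm_sum_sub_sq_le {E : Type*} [NormedAddCommGroup E] [InnerProductSpace ℂ E]
    {S : Set E} (hS : ∀ z ∈ S, ‖z‖ ≤ 1) {x : E} (hx : x ∈ convexHull ℝ S) (D : ℕ) :
    ∃ z : Fin D → E, (∀ i, z i ∈ S) ∧ ‖∑ i, z i - D • x‖ ^ 2 ≤ D := by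
  induction D with
  | zero => exact ⟨Fin.elim0, fun i => i.elim0, by simp⟩
  | succ D ih =>
    obtain ⟨z, hz, hD⟩ := ih
    set y := ∑ i, z i - D • x with hy
    -- testing against `y - x` rather than `y` makes the increment at most `‖w‖ ^ 2 - ‖x‖ ^ 2`
    obtain ⟨w, hw, hwx⟩ := exists_re_inner_le_of_mem_convexHull hx (y - x)
    refine ⟨Fin.snoc z w, fun i => ?_, ?_⟩
    · refine Fin.lastCases ?_ (fun j => ?_) i
      · simpa using hw
      · simpa using hz j
    · have h1 : ∑ i, (Fin.snoc z w : Fin (D + 1) → E) i - (D + 1) • x = y + (w - x) := by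
        rw [Fin.sum_univ_castSucc, hy, succ_nsmul]
        simp only [Fin.snoc_castSucc, Fin.snoc_last]
        abel
      have h2 := norm_add_sq (𝕜 := ℂ) y (w - x)
      have h3 := norm_sub_sq (𝕜 := ℂ) w x
      have h4 : (inner ℂ x x : ℂ).re = ‖x‖ ^ 2 := by
        rw [inner_self_eq_norm_sq_to_K]; norm_cast
      have h5 : (inner ℂ w x : ℂ).re = (inner ℂ x w : ℂ).re := by
        rw [← inner_conj_symm, Complex.conj_re]
      simp only [inner_sub_left, inner_sub_right, map_sub, Complex.sub_re, RCLike.re_to_complex]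
        at h2 h3 hwx
      have h6 : ‖w‖ ^ 2 ≤ 1 := by
        have := hS w hw
        nlinarith [norm_nonneg w]
      rw [h1]
      push_cast
      nlinarith [sq_nonneg ‖x‖]

/-- A vector of projective norm less than `J` is within `J / √D` of a vector of Schmidt rank at
most `D`. -/
theorem exists_schmidtRank_le_norm_sub_le [DecidableEq a] {v : EuclideanSpace ℂ (a × b)} {J : ℝ}
    (hv : productNorm a b v < J) {D : ℕ} (hD : 1 ≤ D) :
    ∃ φ, schmidtRank φ ≤ D ∧ ‖v - φ‖ ≤ J / √D := by
  obtain ⟨r, hr0, hr, x, hx, rfl⟩ := exists_lt_of_gauge_lt absorbent_convexHull_productBall hv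
  obtain ⟨z, hz, hzD⟩ := exists_norm_sum_sub_sq_le
    (fun z hz => norm_le_one_of_mem_productBall hz) hx D
  choose φ χ _ _ hz using hz
  refine ⟨((r / D : ℝ) : ℂ) • ∑ i, z i, ?_, ?_⟩
  · refine (schmidtRank_smul_le _ _).trans ?_
    simp only [hz]
    exact schmidtRank_sum_productState_le φ χ
  · have hD' : (0 : ℝ) < D := by exact_mod_cast hD
    have h1 : (fun x => r • x) x - ((r / D : ℝ) : ℂ) • ∑ i, z i =
        -((r / D : ℝ) : ℂ) • (∑ i, z i - D • x) := by
      rw [Complex.coe_smul, neg_smul, Complex.coe_smul, smul_sub, ← Nat.cast_smul_eq_nsmul ℝ,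
        smul_smul, div_mul_cancel₀ _ hD'.ne']
      simp
    rw [h1, norm_smul, norm_neg, Complex.norm_real, Real.norm_of_nonneg (by positivity)]
    have h2 : ‖∑ i, z i - D • x‖ ≤ √D := Real.le_sqrt_of_sq_le hzD
    calc r / D * ‖∑ i, z i - D • x‖ ≤ r / D * √D := by gcongr
      _ = r / √D := by
        rw [div_mul_eq_mul_div, div_eq_div_iff hD'.ne' (by positivity), mul_assoc,
          Real.mul_self_sqrt hD'.le]
      _ ≤ J / √D := by gcongr

end ProductNorm

/-! ### Schmidt decomposition -/

section Schmidt

variable {a b : Type*} [Fintype a] [DecidableEq a] [Fintype b]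

/-- The left Schmidt vectors of `ψ`: the eigenvectors of `ρ_A`. -/
noncomputable def schmidtLeft (ψ : EuclideanSpace ℂ (a × b)) :
    OrthonormalBasis a ℂ (EuclideanSpace ℂ a) :=
  (reducedDensity_isHermitian ψ).eigenvectorBasis

/-- The right Schmidt vectors of `ψ`, scaled by the Schmidt coefficients: the partial inner
products of `ψ` with the left Schmidt vectors. -/
noncomputable def schmidtRight (ψ : EuclideanSpace ℂ (a × b)) (s : a) : EuclideanSpace ℂ b :=
  WithLp.toLp 2 fun j => ∑ i, star (schmidtLeft ψ s i) * ψ (i, j)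

theorem schmidtRight_apply (ψ : EuclideanSpace ℂ (a × b)) (s : a) (j : b) :
    schmidtRight ψ s j = ∑ i, star (schmidtLeft ψ s i) * ψ (i, j) := rfl

theorem schmidtCoeff_nonneg (ψ : EuclideanSpace ℂ (a × b)) (s : a) : 0 ≤ schmidtCoeff ψ s :=
  Real.sqrt_nonneg _

theorem schmidtCoeff_sq (ψ : EuclideanSpace ℂ (a × b)) (s : a) :
    schmidtCoeff ψ s ^ 2 = (reducedDensity_isHermitian ψ).eigenvalues s :=
  Real.sq_sqrt ((Matrix.posSemidef_self_mul_conjTranspose (coeffMatrix ψ)).eigenvalues_nonneg s)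

theorem norm_schmidtRight_sq (ψ : EuclideanSpace ℂ (a × b)) (s : a) :
    ‖schmidtRight ψ s‖ ^ 2 = schmidtCoeff ψ s ^ 2 := by
  set u := schmidtLeft ψ s with hu
  have h1 : reducedDensity ψ *ᵥ ⇑u = (schmidtCoeff ψ s ^ 2 : ℝ) • ⇑u := by
    rw [schmidtCoeff_sq]
    exact (reducedDensity_isHermitian ψ).mulVec_eigenvectorBasis s
  have h2 : star (⇑u) ⬝ᵥ ⇑u = 1 := by
    have : ‖u‖ = 1 := (schmidtLeft ψ).orthonormal.1 s
    rw [dotProduct_comm]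
    have h := EuclideanSpace.inner_eq_star_dotProduct u u
    rw [← h, inner_self_eq_norm_sq_to_K, this]
    simp
  have h3 : ⇑(schmidtRight ψ s) = star (⇑u) ᵥ* coeffMatrix ψ := by
    ext j
    simp [schmidtRight_apply, Matrix.vecMul, dotProduct, coeffMatrix, hu]
  have h4 : (‖schmidtRight ψ s‖ ^ 2 : ℂ) = (schmidtCoeff ψ s ^ 2 : ℝ) := by
    have h := EuclideanSpace.inner_eq_star_dotProduct (schmidtRight ψ s) (schmidtRight ψ s)
    rw [inner_self_eq_norm_sq_to_K] at h
    have h5 : star (star (⇑u) ᵥ* coeffMatrix ψ) = (coeffMatrix ψ)ᴴ *ᵥ ⇑u := by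
      rw [Matrix.star_vecMul, star_star]
    rw [h3, h5, ← Matrix.dotProduct_mulVec, Matrix.mulVec_mulVec] at h
    change _ = star ⇑u ⬝ᵥ reducedDensity ψ *ᵥ ⇑u at h
    rw [h1, dotProduct_smul, h2] at h
    simpa using h
  exact_mod_cast h4

theorem norm_schmidtRight (ψ : EuclideanSpace ℂ (a × b)) (s : a) :
    ‖schmidtRight ψ s‖ = schmidtCoeff ψ s :=
  (sq_eq_sq₀ (norm_nonneg _) (schmidtCoeff_nonneg _ _)).mp (norm_schmidtRight_sq ψ s)

/-- The Schmidt decomposition, with the coefficients absorbed into the right vectors. -/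
theorem eq_sum_productState_schmidt (ψ : EuclideanSpace ℂ (a × b)) :
    ψ = ∑ s, productState (schmidtLeft ψ s) (schmidtRight ψ s) := by
  ext ⟨i, j⟩
  have h := (schmidtLeft ψ).sum_repr' (WithLp.toLp 2 fun i => ψ (i, j))
  have h' := congrArg (fun v : EuclideanSpace ℂ a => v i) h
  simp only [WithLp.ofLp_sum, Finset.sum_apply, PiLp.smul_apply, smul_eq_mul] at h'
  rw [WithLp.ofLp_sum, Finset.sum_apply, ← h']
  refine Finset.sum_congr rfl fun s _ => ?_
  rw [productState_apply, mul_comm, schmidtRight_apply]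
  congr 1
  simp [PiLp.inner_apply, mul_comm]

theorem sum_schmidtCoeff_sq (ψ : EuclideanSpace ℂ (a × b)) :
    ∑ s, schmidtCoeff ψ s ^ 2 = ‖ψ‖ ^ 2 := by
  have h1 : ∀ j, ∑ s, ‖schmidtRight ψ s j‖ ^ 2 = ∑ i, ‖ψ (i, j)‖ ^ 2 := by
    intro j
    have h := (schmidtLeft ψ).sum_sq_norm_inner_right (WithLp.toLp 2 fun i => ψ (i, j))
    rw [EuclideanSpace.norm_sq_eq] at h
    rw [← h]
    refine Finset.sum_congr rfl fun s _ => ?_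
    congr 2
    simp [PiLp.inner_apply, schmidtRight_apply, mul_comm]
  simp_rw [← norm_schmidtRight_sq, EuclideanSpace.norm_sq_eq]
  rw [Finset.sum_comm, Fintype.sum_prod_type_right]
  exact Finset.sum_congr rfl fun j _ => h1 j

theorem inner_productState_schmidt (ψ : EuclideanSpace ℂ (a × b)) (s : a) :
    inner ℂ (productState (schmidtLeft ψ s) (schmidtRight ψ s)) ψ =
      ((schmidtCoeff ψ s ^ 2 : ℝ) : ℂ) := by
  rw [← norm_schmidtRight_sq]
  push_cast
  have h := inner_self_eq_norm_sq_to_K (𝕜 := ℂ) (schmidtRight ψ s)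
  refine Eq.trans ?_ h
  rw [PiLp.inner_apply, PiLp.inner_apply, Fintype.sum_prod_type_right]
  refine Finset.sum_congr rfl fun j _ => ?_
  rw [schmidtRight_apply]
  simp only [RCLike.inner_apply, productState_apply, Finset.sum_mul, map_mul]
  refine Finset.sum_congr rfl fun i _ => ?_
  rw [schmidtRight_apply]
  simp only [Complex.star_def]
  ring

/-- A unit vector has overlap `max_s λ_s` with some normalized product vector. -/
theorem exists_productState_inner_eq {ψ : EuclideanSpace ℂ (a × b)} (hψ : ‖ψ‖ = 1) :
    ∃ φ χ, ‖φ‖ = 1 ∧ ‖χ‖ = 1 ∧ 0 ≤ renyiInfEntropy ψ ∧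
      ‖inner ℂ ψ (productState φ χ)‖ = Real.exp (-renyiInfEntropy ψ / 2) := by
  have hsum := sum_schmidtCoeff_sq ψ
  rw [hψ, one_pow] at hsum
  have hne : Nonempty a := by
    by_contra h
    rw [not_nonempty_iff] at h
    simp at hsum
  obtain ⟨s, hs⟩ := exists_eq_ciSup_of_finite (f := fun s => schmidtCoeff ψ s ^ 2)
  have hle : ∀ t, schmidtCoeff ψ t ^ 2 ≤ schmidtCoeff ψ s ^ 2 := fun t => by
    rw [hs]
    exact le_ciSup (f := fun s => schmidtCoeff ψ s ^ 2) (Set.finite_range _).bddAbove t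
  have hpos : 0 < schmidtCoeff ψ s := by
    refine (schmidtCoeff_nonneg ψ s).lt_of_ne fun h => ?_
    have : ∑ t, schmidtCoeff ψ t ^ 2 ≤ 0 := Finset.sum_nonpos fun t _ => by
      simpa [← h] using hle t
    linarith
  have hS : renyiInfEntropy ψ = -(2 * Real.log (schmidtCoeff ψ s)) := by
    rw [renyiInfEntropy, ← hs, Real.log_pow]
    norm_num
  have hle1 : schmidtCoeff ψ s ≤ 1 := by
    have : schmidtCoeff ψ s ^ 2 ≤ 1 := by
      rw [← hsum]
      exact Finset.single_le_sum (f := fun s => schmidtCoeff ψ s ^ 2)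
        (fun t _ => sq_nonneg _) (Finset.mem_univ s)
    nlinarith
  refine ⟨schmidtLeft ψ s, ((schmidtCoeff ψ s)⁻¹ : ℝ) • schmidtRight ψ s,
    (schmidtLeft ψ).orthonormal.1 s, ?_, ?_, ?_⟩
  · rw [norm_smul, norm_schmidtRight, Real.norm_of_nonneg (by positivity),
      inv_mul_cancel₀ hpos.ne']
  · rw [hS]
    have := Real.log_nonpos hpos.le hle1
    linarith
  · have h1 : productState (schmidtLeft ψ s) (((schmidtCoeff ψ s)⁻¹ : ℝ) • schmidtRight ψ s) =
        ((schmidtCoeff ψ s)⁻¹ : ℝ) • productState (schmidtLeft ψ s) (schmidtRight ψ s) := by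
      simpa using productState_smul_smul_real 1 (schmidtCoeff ψ s)⁻¹ (schmidtLeft ψ s)
        (schmidtRight ψ s)
    rw [h1, norm_inner_symm, ← Complex.coe_smul, inner_smul_left, inner_productState_schmidt, hS]
    rw [norm_mul, RCLike.norm_conj, Complex.norm_real, Complex.norm_real,
      Real.norm_of_nonneg (by positivity), Real.norm_of_nonneg (by positivity), sq, ← mul_assoc,
      inv_mul_cancel₀ hpos.ne', one_mul]
    rw [neg_neg, mul_div_cancel_left₀ _ two_ne_zero, Real.exp_log hpos]

theorem renyiInfEntropy_nonneg {ψ : EuclideanSpace ℂ (a × b)} (hψ : ‖ψ‖ = 1) :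
    0 ≤ renyiInfEntropy ψ := by
  obtain ⟨_, _, _, _, hS, _⟩ := exists_productState_inner_eq hψ
  exact hS

/-- The identification of a system with a trivial ancilla and the system itself. -/
noncomputable def dropAncilla {c : Type*} (φ : EuclideanSpace ℂ (c × Fin 1)) :
    EuclideanSpace ℂ c :=
  WithLp.toLp 2 fun i => φ (i, 0)

theorem norm_dropAncilla {c : Type*} [Fintype c] (φ : EuclideanSpace ℂ (c × Fin 1)) :
    ‖dropAncilla φ‖ = ‖φ‖ := by
  rw [EuclideanSpace.norm_eq, EuclideanSpace.norm_eq, Fintype.sum_prod_type]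
  simp [dropAncilla]

theorem toEuclideanLin_apply_apply {ι : Type*} [Fintype ι] [DecidableEq ι] (M : Matrix ι ι ℂ)
    (x : EuclideanSpace ℂ ι) (i : ι) : Matrix.toEuclideanLin M x i = ∑ j, M i j * x j := rfl

/-- An operator increases the projective norm at most by its spectral-entangling strength. Only
the trivial ancillas in the definition of the strength are needed. -/
theorem productNorm_le_of_seStrength_le [DecidableEq b] {Φ : Matrix (a × b) (a × b) ℂ} {g : ℝ}
    (hg : 0 ≤ g) (hΦ : seStrength Φ ≤ ENNReal.ofReal g) (x : EuclideanSpace ℂ (a × b)) :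
    productNorm a b (Matrix.toEuclideanLin Φ x) ≤ g * productNorm a b x := by
  have unit : ∀ φ : EuclideanSpace ℂ a, ∀ χ : EuclideanSpace ℂ b, ‖φ‖ = 1 → ‖χ‖ = 1 →
      productNorm a b (Matrix.toEuclideanLin Φ (productState φ χ)) ≤ g := by
    intro φ χ hφ hχ
    set φ' : EuclideanSpace ℂ (a × Fin 1) := WithLp.toLp 2 fun p => φ p.1 with hφ'
    set χ' : EuclideanSpace ℂ (b × Fin 1) := WithLp.toLp 2 fun p => χ p.1 with hχ'
    have h1 : ‖φ'‖ = 1 := by rw [← norm_dropAncilla]; exact hφ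
    have h2 : ‖χ'‖ = 1 := by rw [← norm_dropAncilla]; exact hχ
    set ψ' := Matrix.toEuclideanLin (withAncilla Φ 1 1) (productState φ' χ') with hψ'
    have h3 : ∑ s, schmidtCoeff ψ' s ≤ g := by
      have : ENNReal.ofReal (∑ s, schmidtCoeff ψ' s) ≤ ENNReal.ofReal g := by
        refine le_trans ?_ hΦ
        unfold seStrength
        exact le_iSup_of_le 1 (le_iSup_of_le 1 (le_iSup_of_le φ' (le_iSup_of_le χ'
          (le_iSup_of_le h1 (le_iSup_of_le h2 le_rfl)))))
      exact (ENNReal.ofReal_le_ofReal_iff hg).mp this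
    have h4 : Matrix.toEuclideanLin Φ (productState φ χ) =
        ∑ s, productState (dropAncilla (schmidtLeft ψ' s)) (dropAncilla (schmidtRight ψ' s)) := by
      ext ⟨i, j⟩
      have h5 := congrArg (fun v => v.ofLp ((i, 0), (j, 0))) (eq_sum_productState_schmidt ψ')
      simp only [WithLp.ofLp_sum, Finset.sum_apply] at h5
      rw [WithLp.ofLp_sum, Finset.sum_apply]
      refine Eq.trans ?_ h5
      rw [hψ', toEuclideanLin_apply_apply, toEuclideanLin_apply_apply]
      simp only [Fintype.sum_prod_type, Finset.univ_unique, Fin.default_eq_zero,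
        Finset.sum_singleton]
      refine Finset.sum_congr rfl fun k _ => Finset.sum_congr rfl fun l _ => ?_
      simp [withAncilla, productState_apply, hφ', hχ', Matrix.kroneckerMap_apply]
    rw [h4]
    refine (productNorm_sum_le _ _).trans (le_trans ?_ h3)
    refine Finset.sum_le_sum fun s _ => (productNorm_productState_le _ _).trans ?_
    rw [norm_dropAncilla, norm_dropAncilla, norm_schmidtRight,
      (schmidtLeft ψ').orthonormal.1 s, one_mul]
  refine productNorm_map_le hg (fun φ χ => ?_) x
  rcases eq_or_ne φ 0 with rfl | hφ
  · have : productState (0 : EuclideanSpace ℂ a) χ = 0 := by ext p; simp [productState_apply]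
    simp [this]
  rcases eq_or_ne χ 0 with rfl | hχ
  · have : productState φ (0 : EuclideanSpace ℂ b) = 0 := by ext p; simp [productState_apply]
    simp [this]
  have h1 := unit (‖φ‖⁻¹ • φ) (‖χ‖⁻¹ • χ)
    (by rw [norm_smul, norm_inv, norm_norm, inv_mul_cancel₀ (norm_ne_zero_iff.mpr hφ)])
    (by rw [norm_smul, norm_inv, norm_norm, inv_mul_cancel₀ (norm_ne_zero_iff.mpr hχ)])
  have hpos : 0 < ‖φ‖ * ‖χ‖ := mul_pos (norm_pos_iff.mpr hφ) (norm_pos_iff.mpr hχ)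
  rw [productState_smul_smul_real, ← Complex.coe_smul, map_smul, map_smul_eq_mul,
    Complex.norm_real, Real.norm_of_nonneg (by positivity), ← mul_inv,
    inv_mul_le_iff₀ hpos] at h1
  linarith

end Schmidt

/-! ### Functions of a Hermitian operator -/

section SpectralFunction

variable {ι E : Type*} [Fintype ι] [NormedAddCommGroup E] [InnerProductSpace ℂ E]

/-- The operator that is diagonal in the orthonormal basis `B` with diagonal entries `f`. -/
noncomputable def diagOp (B : OrthonormalBasis ι ℂ E) (f : ι → ℂ) : E →ₗ[ℂ] E where
  toFun x := ∑ k, (f k * inner ℂ (B k) x) • B k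
  map_add' x y := by simp [mul_add, add_smul, Finset.sum_add_distrib]
  map_smul' c x := by
    simp only [inner_smul_right, RingHom.id_apply, Finset.smul_sum, smul_smul]
    exact Finset.sum_congr rfl fun k _ => by congr 1; ring

theorem diagOp_apply (B : OrthonormalBasis ι ℂ E) (f : ι → ℂ) (x : E) :
    diagOp B f x = ∑ k, (f k * inner ℂ (B k) x) • B k := rfl

theorem inner_diagOp (B : OrthonormalBasis ι ℂ E) (f : ι → ℂ) (x : E) (k : ι) :
    inner ℂ (B k) (diagOp B f x) = f k * inner ℂ (B k) x := by
  rw [diagOp_apply, B.orthonormal.inner_right_fintype]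

theorem eq_of_inner_basis_eq (B : OrthonormalBasis ι ℂ E) {x y : E}
    (h : ∀ k, inner ℂ (B k) x = inner ℂ (B k) y) : x = y := by
  rw [← B.sum_repr' x, ← B.sum_repr' y]
  exact Finset.sum_congr rfl fun k _ => by rw [h k]

theorem diagOp_mul_apply (B : OrthonormalBasis ι ℂ E) (f g : ι → ℂ) (x : E) :
    diagOp B (fun k => f k * g k) x = diagOp B f (diagOp B g x) :=
  eq_of_inner_basis_eq B fun k => by simp only [inner_diagOp, mul_assoc]

theorem diagOp_const_one (B : OrthonormalBasis ι ℂ E) (x : E) :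
    diagOp B (fun _ => 1) x = x :=
  eq_of_inner_basis_eq B fun k => by simp only [inner_diagOp, one_mul]

theorem diagOp_const_mul_apply (B : OrthonormalBasis ι ℂ E) (c : ℂ) (f : ι → ℂ) (x : E) :
    diagOp B (fun k => c * f k) x = c • diagOp B f x :=
  eq_of_inner_basis_eq B fun k => by simp only [inner_diagOp, inner_smul_right, mul_assoc]

theorem diagOp_sum_apply {κ : Type*} (s : Finset κ) (B : OrthonormalBasis ι ℂ E)
    (f : κ → ι → ℂ) (x : E) :
    diagOp B (fun k => ∑ j ∈ s, f j k) x = ∑ j ∈ s, diagOp B (f j) x :=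
  eq_of_inner_basis_eq B fun k => by simp only [inner_diagOp, inner_sum, Finset.sum_mul]

theorem norm_diagOp_le (B : OrthonormalBasis ι ℂ E) {f : ι → ℂ} {c : ℝ} (hc : 0 ≤ c) {x : E}
    (hf : ∀ k, inner ℂ (B k) x ≠ 0 → ‖f k‖ ≤ c) : ‖diagOp B f x‖ ≤ c * ‖x‖ := by
  refine le_of_sq_le_sq ?_ (by positivity)
  rw [mul_pow, ← B.sum_sq_norm_inner_right, ← B.sum_sq_norm_inner_right x, Finset.mul_sum]
  refine Finset.sum_le_sum fun k _ => ?_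
  rw [inner_diagOp, norm_mul, mul_pow]
  by_cases h : inner ℂ (B k) x = 0
  · simp [h]
  · have := hf k h
    gcongr

end SpectralFunction

/-! ### Entangling power of the time evolution -/

section Evolution

theorem norm_toEuclideanLin_le {ι : Type*} [Fintype ι] [DecidableEq ι] (M : Matrix ι ι ℂ)
    (x : EuclideanSpace ℂ ι) : ‖Matrix.toEuclideanLin M x‖ ≤ ‖M‖ * ‖x‖ :=
  Matrix.l2_opNorm_mulVec M x

/-- For Hermitian `M` the operator `1 + i h M` is an isometry up to second order in `h`. -/
theorem norm_add_smul_toEuclideanLin_le {ι : Type*} [Fintype ι] [DecidableEq ι]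
    {M : Matrix ι ι ℂ} (hM : M.IsHermitian) (h : ℝ) (x : EuclideanSpace ℂ ι) :
    ‖x + (Complex.I * h) • Matrix.toEuclideanLin M x‖ ≤ (1 + h ^ 2 * ‖M‖ ^ 2) * ‖x‖ := by
  refine le_of_sq_le_sq ?_ (by positivity)
  have h1 : (inner ℂ x (Matrix.toEuclideanLin M x)).im = 0 :=
    (Matrix.isSymmetric_toEuclideanLin_iff.mpr hM).im_inner_self_apply x
  have h2 : (inner ℂ x ((Complex.I * h) • Matrix.toEuclideanLin M x)).re = 0 := by
    rw [inner_smul_right]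
    simp [Complex.mul_re, h1]
  have h3 := norm_add_sq (𝕜 := ℂ) x ((Complex.I * h) • Matrix.toEuclideanLin M x)
  rw [RCLike.re_to_complex, h2, norm_smul, norm_mul, Complex.norm_I, Complex.norm_real,
    Real.norm_eq_abs, mul_pow, one_mul, sq_abs] at h3
  have h4 := norm_toEuclideanLin_le M x
  have h5 : ‖Matrix.toEuclideanLin M x‖ ^ 2 ≤ ‖M‖ ^ 2 * ‖x‖ ^ 2 := by
    rw [← mul_pow]; gcongr
  rw [h3]
  have h6 : h ^ 2 * ‖Matrix.toEuclideanLin M x‖ ^ 2 ≤ h ^ 2 * (‖M‖ ^ 2 * ‖x‖ ^ 2) := by gcongr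
  have h7 : 0 ≤ h ^ 2 * ‖M‖ ^ 2 * ‖x‖ ^ 2 := by positivity
  have h8 : 0 ≤ (h ^ 2 * ‖M‖ ^ 2) ^ 2 * ‖x‖ ^ 2 := by positivity
  nlinarith

theorem isHermitian_hamiltonian {a b : Type*} [DecidableEq a] [DecidableEq b]
    {HA : Matrix a a ℂ} {HB : Matrix b b ℂ}
    {V : Matrix (a × b) (a × b) ℂ} (hA : HA.IsHermitian) (hB : HB.IsHermitian)
    (hV : V.IsHermitian) : (hamiltonian HA HB V).IsHermitian := by
  unfold hamiltonian
  refine Matrix.IsHermitian.add (Matrix.IsHermitian.add ?_ hV) ?_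
  · rw [Matrix.IsHermitian, Matrix.conjTranspose_kronecker, hA.eq, Matrix.conjTranspose_one]
  · rw [Matrix.IsHermitian, Matrix.conjTranspose_kronecker, hB.eq, Matrix.conjTranspose_one]

variable {a b : Type*} [Fintype a] [DecidableEq a] [Fintype b] [DecidableEq b]

theorem toEuclideanLin_hamiltonian_productState (HA : Matrix a a ℂ) (HB : Matrix b b ℂ)
    (V : Matrix (a × b) (a × b) ℂ) (φ : EuclideanSpace ℂ a) (χ : EuclideanSpace ℂ b) :
    Matrix.toEuclideanLin (hamiltonian HA HB V) (productState φ χ) =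
      productState (Matrix.toEuclideanLin HA φ) χ +
        Matrix.toEuclideanLin V (productState φ χ) +
        productState φ (Matrix.toEuclideanLin HB χ) := by
  have hA : Matrix.toEuclideanLin (HA ⊗ₖ (1 : Matrix b b ℂ)) (productState φ χ) =
      productState (Matrix.toEuclideanLin HA φ) χ := by
    ext ⟨i, j⟩
    rw [toEuclideanLin_apply_apply, productState_apply, toEuclideanLin_apply_apply,
      Fintype.sum_prod_type, Finset.sum_mul]
    refine Finset.sum_congr rfl fun k _ => ?_
    rw [Finset.sum_eq_single j]
    · simp [productState_apply, mul_assoc]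
    · intro l _ hl
      simp [Matrix.one_apply_ne hl.symm]
    · simp
  have hB : Matrix.toEuclideanLin ((1 : Matrix a a ℂ) ⊗ₖ HB) (productState φ χ) =
      productState φ (Matrix.toEuclideanLin HB χ) := by
    ext ⟨i, j⟩
    rw [toEuclideanLin_apply_apply, productState_apply, toEuclideanLin_apply_apply,
      Fintype.sum_prod_type_right, Finset.mul_sum]
    refine Finset.sum_congr rfl fun k _ => ?_
    rw [Finset.sum_eq_single i]
    · simp [productState_apply]; ring
    · intro l _ hl
      simp [Matrix.one_apply_ne hl.symm]
    · simp
  rw [hamiltonian, map_add, map_add, LinearMap.add_apply, LinearMap.add_apply, hA, hB]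

theorem toEuclideanLin_eigenvectorBasis {ι : Type*} [Fintype ι] [DecidableEq ι]
    {M : Matrix ι ι ℂ} (hM : M.IsHermitian) (k : ι) :
    Matrix.toEuclideanLin M (hM.eigenvectorBasis k) =
      (hM.eigenvalues k : ℂ) • hM.eigenvectorBasis k := by
  ext i
  have h := congrFun (hM.mulVec_eigenvectorBasis k) i
  simpa using h

theorem toEuclideanLin_eq_diagOp {ι : Type*} [Fintype ι] [DecidableEq ι]
    {M : Matrix ι ι ℂ} (hM : M.IsHermitian) (x : EuclideanSpace ℂ ι) :
    Matrix.toEuclideanLin M x =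
      diagOp hM.eigenvectorBasis (fun k => (hM.eigenvalues k : ℂ)) x := by
  refine eq_of_inner_basis_eq hM.eigenvectorBasis fun k => ?_
  rw [inner_diagOp, ← (Matrix.isSymmetric_toEuclideanLin_iff.mpr hM) _ x,
    toEuclideanLin_eigenvectorBasis, inner_smul_left, Complex.conj_ofReal]

/-- The unitary time evolution `e^{i t M}` of a Hermitian matrix, built from its eigenbasis. -/
noncomputable def evolution {ι : Type*} [Fintype ι] [DecidableEq ι] {M : Matrix ι ι ℂ}
    (hM : M.IsHermitian) (t : ℝ) : EuclideanSpace ℂ ι →ₗ[ℂ] EuclideanSpace ℂ ι :=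
  diagOp hM.eigenvectorBasis fun k => Complex.exp (Complex.I * (t * hM.eigenvalues k : ℝ))

theorem evolution_add_apply {ι : Type*} [Fintype ι] [DecidableEq ι] {M : Matrix ι ι ℂ}
    (hM : M.IsHermitian) (s t : ℝ) (x : EuclideanSpace ℂ ι) :
    evolution hM (s + t) x = evolution hM s (evolution hM t x) := by
  rw [evolution, evolution, evolution, ← diagOp_mul_apply]
  congr 2
  ext k
  rw [← Complex.exp_add]
  push_cast
  ring_nf

theorem evolution_zero_apply {ι : Type*} [Fintype ι] [DecidableEq ι] {M : Matrix ι ι ℂ}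
    (hM : M.IsHermitian) (x : EuclideanSpace ℂ ι) : evolution hM 0 x = x := by
  simp [evolution, diagOp_const_one]

/-- The first-order Taylor remainder of the time evolution. -/
theorem norm_evolution_sub_le {ι : Type*} [Fintype ι] [DecidableEq ι] {M : Matrix ι ι ℂ}
    (hM : M.IsHermitian) {R h : ℝ} (hR : ∀ k, |hM.eigenvalues k| ≤ R) (hh : |h| * R ≤ 1)
    (x : EuclideanSpace ℂ ι) :
    ‖evolution hM h x - (x + (Complex.I * h) • Matrix.toEuclideanLin M x)‖ ≤
      h ^ 2 * R ^ 2 * ‖x‖ := by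
  have h1 : evolution hM h x - (x + (Complex.I * h) • Matrix.toEuclideanLin M x) =
      diagOp hM.eigenvectorBasis (fun k =>
        Complex.exp (Complex.I * (h * hM.eigenvalues k : ℝ)) - 1 -
          Complex.I * (h * hM.eigenvalues k : ℝ)) x := by
    refine eq_of_inner_basis_eq hM.eigenvectorBasis fun k => ?_
    rw [inner_sub_right, inner_add_right, inner_smul_right, toEuclideanLin_eq_diagOp hM, evolution,
      inner_diagOp, inner_diagOp, inner_diagOp]
    push_cast
    ring
  rw [h1]
  refine norm_diagOp_le _ (by positivity) fun k _ => ?_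
  have h2 : ‖Complex.I * (h * hM.eigenvalues k : ℝ)‖ ≤ |h| * R := by
    rw [norm_mul, Complex.norm_I, one_mul, Complex.norm_real, Real.norm_eq_abs, abs_mul]
    exact mul_le_mul_of_nonneg_left (hR k) (abs_nonneg _)
  refine (Complex.norm_exp_sub_one_sub_id_le (h2.trans hh)).trans ?_
  rw [← sq_abs h, ← mul_pow]
  gcongr

/-- To first order in time, only the interaction increases the projective norm. -/
theorem exists_productNorm_evolution_le {HA : Matrix a a ℂ} {HB : Matrix b b ℂ}
    {V : Matrix (a × b) (a × b) ℂ} (hA : HA.IsHermitian) (hB : HB.IsHermitian)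
    (hH : (hamiltonian HA HB V).IsHermitian) {g : ℝ} (hg : 0 ≤ g)
    (hV : seStrength V ≤ ENNReal.ofReal g) :
    ∃ C δ : ℝ, 0 < δ ∧ ∀ h : ℝ, |h| ≤ δ → ∀ x,
      productNorm a b (evolution hH h x) ≤ (1 + g * |h| + C * h ^ 2) * productNorm a b x := by
  set n : ℝ := (Fintype.card (a × b) : ℝ) + 1 with hn
  set R : ℝ := ∑ k, |hH.eigenvalues k| with hR
  have hR0 : 0 ≤ R := Finset.sum_nonneg fun _ _ => abs_nonneg _
  have hRk : ∀ k, |hH.eigenvalues k| ≤ R := fun k =>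
    Finset.single_le_sum (f := fun k => |hH.eigenvalues k|) (fun _ _ => abs_nonneg _)
      (Finset.mem_univ k)
  set α := ‖HA‖
  set β := ‖HB‖
  have hα : 0 ≤ α := norm_nonneg _
  have hβ : 0 ≤ β := norm_nonneg _
  refine ⟨α ^ 2 + β ^ 2 + α ^ 2 * β ^ 2 + α * β + n * R ^ 2, (1 + R)⁻¹, by positivity,
    fun h hh x => ?_⟩
  have hh1 : |h| ≤ 1 := hh.trans (inv_le_one_of_one_le₀ (by linarith))
  have hhR : |h| * R ≤ 1 := by
    calc |h| * R ≤ (1 + R)⁻¹ * (1 + R) := by gcongr; linarith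
      _ = 1 := inv_mul_cancel₀ (by positivity)
  have hsq : h ^ 2 ≤ 1 := by rw [← sq_abs]; nlinarith [abs_nonneg h]
  have hx0 : 0 ≤ productNorm a b x := apply_nonneg _ _
  set L : EuclideanSpace ℂ (a × b) →ₗ[ℂ] EuclideanSpace ℂ (a × b) :=
    LinearMap.id + (Complex.I * h) • Matrix.toEuclideanLin (hamiltonian HA HB V) with hL
  have hLx : ∀ y, L y = y + (Complex.I * h) • Matrix.toEuclideanLin (hamiltonian HA HB V) y :=
    fun y => rfl
  -- `1 + i h H` differs from the local `(1 + i h HA) ⊗ (1 + i h HB)` by `i h V` and order `h ^ 2`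
  have hmain : productNorm a b (L x) ≤
      (1 + g * |h| + (α ^ 2 + β ^ 2 + α ^ 2 * β ^ 2 + α * β) * h ^ 2) * productNorm a b x := by
    refine productNorm_map_le (by positivity) (fun φ χ => ?_) x
    set A := Matrix.toEuclideanLin HA φ with hAφ
    set B := Matrix.toEuclideanLin HB χ with hBχ
    have hsplit : L (productState φ χ) =
        productState (φ + (Complex.I * h) • A) (χ + (Complex.I * h) • B) +
          (Complex.I * h) • Matrix.toEuclideanLin V (productState φ χ) +
          ((h ^ 2 : ℝ) : ℂ) • productState A B := by
      rw [hLx, toEuclideanLin_hamiltonian_productState]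
      ext p
      simp only [PiLp.add_apply, PiLp.smul_apply, productState_apply, smul_eq_mul]
      push_cast
      linear_combination (-(h : ℂ) ^ 2 * A p.1 * B p.2) * Complex.I_sq
    rw [hsplit]
    have e1 : productNorm a b (productState (φ + (Complex.I * h) • A) (χ + (Complex.I * h) • B)) ≤
        (1 + h ^ 2 * α ^ 2) * (1 + h ^ 2 * β ^ 2) * (‖φ‖ * ‖χ‖) := by
      refine (productNorm_productState_le _ _).trans ?_
      calc _ ≤ ((1 + h ^ 2 * α ^ 2) * ‖φ‖) * ((1 + h ^ 2 * β ^ 2) * ‖χ‖) := by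
            gcongr
            · exact norm_add_smul_toEuclideanLin_le hA h φ
            · exact norm_add_smul_toEuclideanLin_le hB h χ
        _ = _ := by ring
    have e2 : productNorm a b ((Complex.I * h) • Matrix.toEuclideanLin V (productState φ χ)) ≤
        |h| * (g * (‖φ‖ * ‖χ‖)) := by
      rw [map_smul_eq_mul, norm_mul, Complex.norm_I, one_mul, Complex.norm_real, Real.norm_eq_abs]
      gcongr
      refine (productNorm_le_of_seStrength_le hg hV _).trans ?_
      gcongr
      exact productNorm_productState_le _ _
    have e3 : productNorm a b (((h ^ 2 : ℝ) : ℂ) • productState A B) ≤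
        h ^ 2 * (α * β * (‖φ‖ * ‖χ‖)) := by
      rw [map_smul_eq_mul, Complex.norm_real, Real.norm_of_nonneg (by positivity)]
      gcongr
      refine (productNorm_productState_le _ _).trans ?_
      calc ‖A‖ * ‖B‖ ≤ (α * ‖φ‖) * (β * ‖χ‖) := by
            gcongr
            · exact norm_toEuclideanLin_le HA φ
            · exact norm_toEuclideanLin_le HB χ
        _ = _ := by ring
    have e4 : (1 + h ^ 2 * α ^ 2) * (1 + h ^ 2 * β ^ 2) ≤
        1 + (α ^ 2 + β ^ 2 + α ^ 2 * β ^ 2) * h ^ 2 := by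
      have : h ^ 2 * (h ^ 2 * (α ^ 2 * β ^ 2)) ≤ 1 * (h ^ 2 * (α ^ 2 * β ^ 2)) := by gcongr
      nlinarith
    have hp : 0 ≤ ‖φ‖ * ‖χ‖ := by positivity
    have e5 := mul_le_mul_of_nonneg_right e4 hp
    refine (map_add_le_add (productNorm a b) _ _).trans ?_
    refine (add_le_add_left (map_add_le_add (productNorm a b) _ _) _).trans ?_
    linarith
  -- the remainder is small in the Hilbert space norm, to which the projective norm is equivalent
  have hrem : productNorm a b (evolution hH h x - L x) ≤ n * R ^ 2 * h ^ 2 * productNorm a b x := by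
    refine (productNorm_le_card_mul_norm _).trans ?_
    have h1 := norm_evolution_sub_le hH hRk hhR x
    rw [← hLx] at h1
    calc n * ‖evolution hH h x - L x‖ ≤ n * (h ^ 2 * R ^ 2 * ‖x‖) := by gcongr
      _ ≤ n * (h ^ 2 * R ^ 2 * productNorm a b x) := by
          gcongr
          exact norm_le_productNorm x
      _ = _ := by ring
  calc productNorm a b (evolution hH h x) = productNorm a b (L x + (evolution hH h x - L x)) := by
        rw [add_sub_cancel]
    _ ≤ productNorm a b (L x) + productNorm a b (evolution hH h x - L x) := map_add_le_add _ _ _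
    _ ≤ _ := by linarith

/-- Small incremental entangling: evolution for a time `t` increases the projective norm by a
factor of at most `e^{g |t|}`, where `g` bounds the spectral-entangling strength of the
interaction. -/
theorem productNorm_evolution_le {HA : Matrix a a ℂ} {HB : Matrix b b ℂ}
    {V : Matrix (a × b) (a × b) ℂ} (hA : HA.IsHermitian) (hB : HB.IsHermitian)
    (hH : (hamiltonian HA HB V).IsHermitian) {g : ℝ} (hg : 0 ≤ g)
    (hV : seStrength V ≤ ENNReal.ofReal g) (t : ℝ) (x : EuclideanSpace ℂ (a × b)) :
    productNorm a b (evolution hH t x) ≤ Real.exp (g * |t|) * productNorm a b x := by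
  obtain ⟨C, δ, hδ, hC⟩ := exists_productNorm_evolution_le hA hB hH hg hV
  have hx0 : 0 ≤ productNorm a b x := apply_nonneg _ _
  -- compose `n` short evolutions and let `n` tend to infinity
  have iter : ∀ h : ℝ, |h| ≤ δ → ∀ n : ℕ, productNorm a b (evolution hH (n * h) x) ≤
      Real.exp (n * (g * |h| + C * h ^ 2)) * productNorm a b x := by
    intro h hh n
    induction n with
    | zero => simp [evolution_zero_apply]
    | succ n ih =>
      have h1 : ((n + 1 : ℕ) : ℝ) * h = h + n * h := by push_cast; ring
      rw [h1, evolution_add_apply]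
      have h2 : 1 + g * |h| + C * h ^ 2 ≤ Real.exp (g * |h| + C * h ^ 2) := by
        have := Real.add_one_le_exp (g * |h| + C * h ^ 2)
        linarith
      calc _ ≤ (1 + g * |h| + C * h ^ 2) * productNorm a b (evolution hH (n * h) x) :=
            hC h hh _
        _ ≤ Real.exp (g * |h| + C * h ^ 2) *
            (Real.exp (n * (g * |h| + C * h ^ 2)) * productNorm a b x) := by
          have h3 : 0 ≤ productNorm a b (evolution hH (n * h) x) := apply_nonneg _ _
          gcongr
        _ = _ := by
          rw [← mul_assoc, ← Real.exp_add]
          push_cast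
          ring_nf
  have hlim : Filter.Tendsto (fun n : ℕ => Real.exp (g * |t| + C * t ^ 2 / n) * productNorm a b x)
      Filter.atTop (nhds (Real.exp (g * |t| + 0) * productNorm a b x)) := by
    refine Filter.Tendsto.mul_const _ ?_
    refine (Real.continuous_exp.tendsto _).comp (Filter.Tendsto.const_add _ ?_)
    exact tendsto_const_div_atTop_nhds_zero_nat _
  rw [add_zero] at hlim
  refine ge_of_tendsto hlim ?_
  obtain ⟨N, hN⟩ := exists_nat_gt (|t| / δ)
  filter_upwards [Filter.eventually_ge_atTop (N + 1)] with n hn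
  have hn0 : (0 : ℝ) < n := by exact_mod_cast (by omega : 0 < n)
  have hNn : (N : ℝ) ≤ n := by exact_mod_cast (by omega : N ≤ n)
  have habs : |t / n| = |t| / n := by rw [abs_div, abs_of_pos hn0]
  have h1 := iter (t / n) (by
    rw [habs, div_le_iff₀ hn0]
    rw [div_lt_iff₀ hδ] at hN
    nlinarith) n
  rw [mul_div_cancel₀ _ hn0.ne', habs] at h1
  have h2 : n * (g * (|t| / n) + C * (t / n) ^ 2) = g * |t| + C * t ^ 2 / n := by
    field_simp
  rwa [h2] at h1

end Evolution

/-! ### A low-pass filter supported on short times -/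

section Filter

theorem cos_le_exp_neg_sq_div_two {x : ℝ} (hx : |x| ≤ 1) :
    Real.cos x ≤ Real.exp (-(x ^ 2 / 2)) := by
  have h1 := (abs_le.mp (Real.cos_bound hx)).2
  have hsq : x ^ 2 ≤ 1 := by rw [← sq_abs]; nlinarith [abs_nonneg x]
  have h2 : |-(x ^ 2 / 2)| ≤ 1 := by rw [abs_neg, abs_of_nonneg (by positivity)]; linarith
  have h3 := (abs_le.mp (Real.exp_bound h2 (n := 3) (by norm_num))).1
  rw [abs_neg, abs_of_nonneg (by positivity : (0 : ℝ) ≤ x ^ 2 / 2)] at h3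
  norm_num [Finset.sum_range_succ, Nat.factorial] at h3
  have h4 : |x| ^ 4 = (x ^ 2) ^ 2 := by rw [← sq_abs x]; ring
  rw [h4] at h1
  have h5 : (x ^ 2) ^ 3 ≤ (x ^ 2) ^ 2 := by nlinarith [sq_nonneg (x ^ 2)]
  nlinarith [sq_nonneg (x ^ 2)]

/-- The moment generating function of a symmetric binomial distribution of step `h`. -/
theorem sum_choose_mul_exp (n : ℕ) (h : ℝ) (z : ℂ) :
    ∑ j ∈ Finset.range (n + 1), ((n.choose j / 2 ^ n : ℝ) : ℂ) *
      Complex.exp (z * (h * (n - 2 * j) : ℝ)) = Complex.cosh (z * h) ^ n := by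
  rw [Complex.cosh, div_pow, add_comm (Complex.exp _), add_pow, Finset.sum_div]
  refine Finset.sum_congr rfl fun j hj => ?_
  have hj' : j ≤ n := Nat.lt_succ_iff.mp (Finset.mem_range.mp hj)
  rw [← Complex.exp_nat_mul, ← Complex.exp_nat_mul, ← Complex.exp_add]
  push_cast [Nat.cast_sub hj']
  ring_nf

/-- Chernoff's bound for the symmetric binomial distribution, with variance `T / Δ`. -/
theorem sum_choose_tail_le {n : ℕ} {h T Δ : ℝ} (hn : n * h ^ 2 * Δ = T) (hΔ : 0 < Δ) :
    ∑ j ∈ Finset.range (n + 1), (if |h * (n - 2 * j)| ≤ T then 0 else (n.choose j / 2 ^ n : ℝ)) ≤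
      2 * Real.exp (-(T * Δ / 2)) := by
  have hmgf : ∀ l : ℝ, ∑ j ∈ Finset.range (n + 1), (n.choose j / 2 ^ n : ℝ) *
      Real.exp (l * (h * (n - 2 * j))) = Real.cosh (l * h) ^ n := fun l => by
    have := sum_choose_mul_exp n h l
    exact_mod_cast this
  have hmgf' : ∀ l : ℝ, l ^ 2 = Δ ^ 2 → ∑ j ∈ Finset.range (n + 1), (n.choose j / 2 ^ n : ℝ) *
      Real.exp (l * (h * (n - 2 * j)) - Δ * T) ≤ Real.exp (-(T * Δ / 2)) := fun l hl => by
    simp_rw [Real.exp_sub, ← mul_div_assoc]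
    rw [← Finset.sum_div, hmgf, div_le_iff₀ (Real.exp_pos _), ← Real.exp_add]
    calc Real.cosh (l * h) ^ n ≤ Real.exp ((l * h) ^ 2 / 2) ^ n := by
          gcongr
          exact Real.cosh_le_exp_half_sq _
      _ = Real.exp (-(T * Δ / 2) + Δ * T) := by
          rw [← Real.exp_nat_mul, mul_pow, hl, ← hn]
          ring_nf
  calc _ ≤ ∑ j ∈ Finset.range (n + 1), ((n.choose j / 2 ^ n : ℝ) *
        Real.exp (Δ * (h * (n - 2 * j)) - Δ * T) + (n.choose j / 2 ^ n : ℝ) *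
        Real.exp (-Δ * (h * (n - 2 * j)) - Δ * T)) := by
        refine Finset.sum_le_sum fun j _ => ?_
        have hp : (0 : ℝ) ≤ n.choose j / 2 ^ n := by positivity
        split_ifs with hj
        · positivity
        · rw [not_le, lt_abs] at hj
          rcases hj with hj | hj
          · have : 1 ≤ Real.exp (Δ * (h * (n - 2 * j)) - Δ * T) := Real.one_le_exp (by nlinarith)
            have h2 : (0 : ℝ) ≤ n.choose j / 2 ^ n * Real.exp (-Δ * (h * (n - 2 * j)) - Δ * T) := by
              positivity
            nlinarith
          · have : 1 ≤ Real.exp (-Δ * (h * (n - 2 * j)) - Δ * T) := Real.one_le_exp (by nlinarith)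
            have h2 : (0 : ℝ) ≤ n.choose j / 2 ^ n * Real.exp (Δ * (h * (n - 2 * j)) - Δ * T) := by
              positivity
            nlinarith
    _ ≤ _ := by
        rw [Finset.sum_add_distrib]
        have h1 := hmgf' Δ rfl
        have h2 := hmgf' (-Δ) (by ring)
        linarith

/-- There is a probability distribution on times in `[-T, T]` whose Fourier transform is at most
`5 e^{-TΔ/2}` at all frequencies between `Δ` and `R`. It is a binomial approximation of the
Gaussian distribution of variance `T / Δ`, with the mass outside `[-T, T]` moved to time zero. -/
theorem exists_filter {T Δ : ℝ} (hT : 0 ≤ T) (hΔ : 0 < Δ) (R : ℝ) :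
    ∃ (n : ℕ) (p τ : ℕ → ℝ), (∀ j, 0 ≤ p j) ∧ ∑ j ∈ Finset.range n, p j = 1 ∧ (∀ j, |τ j| ≤ T) ∧
      ∀ E, Δ ≤ E → E ≤ R →
        ‖∑ j ∈ Finset.range n, (p j : ℂ) * Complex.exp (Complex.I * (τ j * E : ℝ))‖ ≤
          5 * Real.exp (-(T * Δ / 2)) := by
  rcases hT.eq_or_lt with rfl | hT
  · refine ⟨1, fun _ => 1, fun _ => 0, by simp, by simp, by simp, fun E _ _ => ?_⟩
    simp
  -- so many steps that `E * h ≤ 1` for all frequencies `E ≤ R`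
  obtain ⟨n, hn⟩ := exists_nat_gt (T * R ^ 2 / Δ)
  have hn0 : (0 : ℝ) < n := lt_of_le_of_lt (by positivity) hn
  -- the step is chosen so that the variance `n h ^ 2` equals `T / Δ`
  set h := √(T / (n * Δ)) with hh
  have hh2 : h ^ 2 = T / (n * Δ) := Real.sq_sqrt (by positivity)
  have hvar : n * h ^ 2 * Δ = T := by rw [hh2]; field_simp
  set σ : ℕ → ℝ := fun j => h * (n - 2 * j) with hσ
  set p : ℕ → ℝ := fun j => n.choose j / 2 ^ n with hp
  set τ : ℕ → ℝ := fun j => if |σ j| ≤ T then σ j else 0 with hτ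
  have hp0 : ∀ j, 0 ≤ p j := fun j => by positivity
  refine ⟨n + 1, p, τ, hp0, ?_, fun j => ?_, fun E hE1 hE2 => ?_⟩
  · rw [← Finset.sum_div, div_eq_one_iff_eq (by positivity)]
    exact_mod_cast Nat.sum_range_choose n
  · simp only [hτ]
    split_ifs with hj
    · exact hj
    · simpa using hT.le
  · have hsplit : ∑ j ∈ Finset.range (n + 1), (p j : ℂ) * Complex.exp (Complex.I * (τ j * E : ℝ)) =
        ∑ j ∈ Finset.range (n + 1), (p j : ℂ) * Complex.exp (Complex.I * E * (σ j : ℝ)) +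
        ∑ j ∈ Finset.range (n + 1), (p j : ℂ) * (Complex.exp (Complex.I * (τ j * E : ℝ)) -
          Complex.exp (Complex.I * (σ j * E : ℝ))) := by
      rw [← Finset.sum_add_distrib]
      refine Finset.sum_congr rfl fun j _ => ?_
      push_cast
      ring_nf
    have hxE : |E * h| ≤ 1 := by
      have hE0 : 0 < E := hΔ.trans_le hE1
      rw [abs_of_nonneg (by positivity)]
      refine le_of_sq_le_sq ?_ zero_le_one
      rw [mul_pow, hh2, one_pow]
      rw [div_lt_iff₀ hΔ] at hn
      rw [mul_div_assoc', div_le_one (by positivity)]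
      have : E ^ 2 ≤ R ^ 2 := by gcongr
      nlinarith
    have hgauss : ‖∑ j ∈ Finset.range (n + 1), (p j : ℂ) *
        Complex.exp (Complex.I * E * (σ j : ℝ))‖ ≤ Real.exp (-(T * Δ / 2)) := by
      have h1 := sum_choose_mul_exp n h (Complex.I * E)
      have h2 : Complex.cosh (Complex.I * E * h) = (Real.cos (E * h) : ℝ) := by
        rw [mul_assoc, mul_comm, Complex.cosh_mul_I]
        push_cast
        rfl
      rw [h2] at h1
      rw [h1, norm_pow, Complex.norm_real, Real.norm_eq_abs]
      have hcos : 0 ≤ Real.cos (E * h) := by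
        have h3 := Real.one_sub_sq_div_two_le_cos (x := E * h)
        have h4 : (E * h) ^ 2 ≤ 1 := by rw [← sq_abs]; nlinarith [abs_nonneg (E * h)]
        linarith
      rw [abs_of_nonneg hcos]
      calc Real.cos (E * h) ^ n ≤ Real.exp (-((E * h) ^ 2 / 2)) ^ n := by
            gcongr
            exact cos_le_exp_neg_sq_div_two hxE
        _ ≤ _ := by
            rw [← Real.exp_nat_mul, Real.exp_le_exp, ← hvar]
            have : Δ ^ 2 ≤ E ^ 2 := by gcongr
            have h5 : 0 ≤ n * h ^ 2 := by positivity
            nlinarith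
    have htail : ‖∑ j ∈ Finset.range (n + 1), (p j : ℂ) *
        (Complex.exp (Complex.I * (τ j * E : ℝ)) - Complex.exp (Complex.I * (σ j * E : ℝ)))‖ ≤
        4 * Real.exp (-(T * Δ / 2)) := by
      refine (norm_sum_le _ _).trans ?_
      calc _ ≤ ∑ j ∈ Finset.range (n + 1), 2 * (if |σ j| ≤ T then 0 else p j) := by
            refine Finset.sum_le_sum fun j _ => ?_
            rw [norm_mul, Complex.norm_real, Real.norm_of_nonneg (hp0 j)]
            simp only [hτ]
            split_ifs with hj
            · simp
            · have := norm_sub_le (Complex.exp (Complex.I * ((0 : ℝ) * E : ℝ)))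
                (Complex.exp (Complex.I * (σ j * E : ℝ)))
              rw [Complex.norm_exp_I_mul_ofReal, Complex.norm_exp_I_mul_ofReal] at this
              nlinarith [hp0 j]
        _ ≤ _ := by
            rw [← Finset.mul_sum]
            have := sum_choose_tail_le hvar hΔ
            linarith
    rw [hsplit]
    refine (norm_add_le _ _).trans ?_
    linarith

end Filter

/-! ### Approximate ground state projections -/

section GroundState

variable {ι : Type*} [Fintype ι] [DecidableEq ι] {H : Matrix ι ι ℂ} {E₀ Δ : ℝ}
  {Ω : EuclideanSpace ℂ ι}

theorem hasEigenvalue_eigenvalues (hH : H.IsHermitian) (k : ι) :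
    Module.End.HasEigenvalue (Matrix.toEuclideanLin H) (hH.eigenvalues k : ℂ) := by
  refine Module.End.hasEigenvalue_of_hasEigenvector (x := hH.eigenvectorBasis k) ⟨?_, ?_⟩
  · rw [Module.End.mem_eigenspace_iff]
    exact toEuclideanLin_eigenvectorBasis hH k
  · have h := hH.eigenvectorBasis.orthonormal.1 k
    intro h0
    rw [h0, norm_zero] at h
    exact zero_ne_one h

/-- Components of vectors orthogonal to the ground state lie above the gap. -/
theorem IsNondegenerateGroundState.gap_le (hΩ : IsNondegenerateGroundState H E₀ Ω)
    (hgap : SpectralGapGE H E₀ Δ) (hH : H.IsHermitian) {w : EuclideanSpace ℂ ι}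
    (hw : inner ℂ Ω w = 0) {k : ι} (hk : inner ℂ (hH.eigenvectorBasis k) w ≠ 0) :
    Δ ≤ hH.eigenvalues k - E₀ := by
  refine hgap _ (hasEigenvalue_eigenvalues hH k) fun h => hk ?_
  obtain ⟨c, hc⟩ := hΩ.nondegenerate (hH.eigenvectorBasis k) (by
    rw [toEuclideanLin_eigenvectorBasis, h])
  rw [hc, inner_smul_left, hw, mul_zero]

theorem IsNondegenerateGroundState.eigenvalue_eq (hΩ : IsNondegenerateGroundState H E₀ Ω)
    (hH : H.IsHermitian) {k : ι} (hk : inner ℂ (hH.eigenvectorBasis k) Ω ≠ 0) :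
    hH.eigenvalues k = E₀ := by
  have h1 := inner_diagOp hH.eigenvectorBasis (fun k => (hH.eigenvalues k : ℂ)) Ω k
  rw [← toEuclideanLin_eq_diagOp hH, hΩ.eigenvector, inner_smul_right] at h1
  exact_mod_cast (mul_right_cancel₀ hk h1).symm

/-- For a Hamiltonian whose interaction has spectral-entangling strength at most `g`, averaging
the time evolution against a filter supported on `[-T, T]` fixes the ground state, suppresses its
complement by `5 e^{-TΔ/2}`, and increases the projective norm at most by `e^{g T}`. -/
theorem exists_approx_groundState_projection {a b : Type*} [Fintype a] [DecidableEq a] [Fintype b]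
    [DecidableEq b] {HA : Matrix a a ℂ} {HB : Matrix b b ℂ} {V : Matrix (a × b) (a × b) ℂ}
    (hA : HA.IsHermitian) (hB : HB.IsHermitian) (hVh : V.IsHermitian) {g E₀ Δ : ℝ} (hg : 0 ≤ g)
    (hV : seStrength V ≤ ENNReal.ofReal g) {Ω : EuclideanSpace ℂ (a × b)}
    (hΩ : IsNondegenerateGroundState (hamiltonian HA HB V) E₀ Ω) (hΔ : 0 < Δ)
    (hgap : SpectralGapGE (hamiltonian HA HB V) E₀ Δ) {T : ℝ} (hT : 0 ≤ T) :
    ∃ K : EuclideanSpace ℂ (a × b) →ₗ[ℂ] EuclideanSpace ℂ (a × b), K Ω = Ω ∧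
      (∀ w, inner ℂ Ω w = 0 →
        inner ℂ Ω (K w) = 0 ∧ ‖K w‖ ≤ 5 * Real.exp (-(T * Δ / 2)) * ‖w‖) ∧
      ∀ x, productNorm a b (K x) ≤ Real.exp (g * T) * productNorm a b x := by
  have hH := isHermitian_hamiltonian hA hB hVh
  set B := hH.eigenvectorBasis with hB'
  set e := hH.eigenvalues with he
  obtain ⟨n, p, τ, hp0, hp1, hτ, hfil⟩ := exists_filter hT hΔ (∑ k, |e k - E₀|)
  set F : ℕ → (a × b) → ℂ := fun j k =>
    (p j : ℂ) * Complex.exp (Complex.I * (τ j * (e k - E₀) : ℝ)) with hF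
  set f : (a × b) → ℂ := fun k => ∑ j ∈ Finset.range n, F j k with hf
  refine ⟨diagOp B f, ?_, fun w hw => ⟨?_, ?_⟩, fun x => ?_⟩
  · refine eq_of_inner_basis_eq B fun k => ?_
    rw [inner_diagOp]
    by_cases hk : inner ℂ (B k) Ω = 0
    · rw [hk, mul_zero]
    · have h1 : e k = E₀ := hΩ.eigenvalue_eq hH hk
      have h2 : f k = 1 := by
        simp only [hf, hF, h1, sub_self, mul_zero, Complex.ofReal_zero, Complex.exp_zero, mul_one]
        exact_mod_cast hp1
      rw [h2, one_mul]
  · rw [← B.sum_inner_mul_inner]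
    refine Finset.sum_eq_zero fun k _ => ?_
    rw [inner_diagOp]
    by_cases hk : inner ℂ (B k) w = 0
    · rw [hk, mul_zero, mul_zero]
    · by_cases hk' : inner ℂ (B k) Ω = 0
      · rw [← inner_conj_symm, hk', map_zero, zero_mul]
      · have h1 := hΩ.gap_le hgap hH hw hk
        have h2 := hΩ.eigenvalue_eq hH hk'
        linarith
  · refine norm_diagOp_le B (by positivity) fun k hk => ?_
    refine hfil _ (hΩ.gap_le hgap hH hw hk) ?_
    exact (le_abs_self _).trans (Finset.single_le_sum (f := fun k => |e k - E₀|)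
      (fun _ _ => abs_nonneg _) (Finset.mem_univ k))
  · have h1 : ∀ j, diagOp B (F j) x =
        ((p j : ℂ) * Complex.exp (Complex.I * (-(τ j * E₀) : ℝ))) • evolution hH (τ j) x := by
      intro j
      rw [evolution, ← diagOp_const_mul_apply]
      congr 2
      ext k
      simp only [hF, he]
      rw [mul_assoc, ← Complex.exp_add]
      push_cast
      ring_nf
    rw [hf, diagOp_sum_apply]
    refine (productNorm_sum_le _ _).trans ?_
    have hx0 : 0 ≤ productNorm a b x := apply_nonneg _ _
    calc _ ≤ ∑ j ∈ Finset.range n, p j * (Real.exp (g * T) * productNorm a b x) := by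
          refine Finset.sum_le_sum fun j _ => ?_
          rw [h1, map_smul_eq_mul, norm_mul, Complex.norm_exp_I_mul_ofReal, mul_one,
            Complex.norm_real, Real.norm_of_nonneg (hp0 j)]
          have h2 := hp0 j
          gcongr
          refine (productNorm_evolution_le hA hB hH hg hV (τ j) x).trans ?_
          gcongr
          exact hτ j
      _ = _ := by rw [← Finset.sum_mul, hp1, one_mul]

end GroundState

/-! ### Changing the reference state -/

section Rest

variable {E : Type*} [NormedAddCommGroup E] [InnerProductSpace ℂ E]

/-- The component of `v` orthogonal to the unit vector `Ω`. -/
noncomputable def rest (Ω v : E) : E := v - inner ℂ Ω v • Ω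

theorem inner_rest {Ω : E} (hΩ : ‖Ω‖ = 1) (v : E) : inner ℂ Ω (rest Ω v) = 0 := by
  rw [rest, inner_sub_right, inner_smul_right, inner_self_eq_norm_sq_to_K, hΩ]
  simp

theorem smul_add_rest (Ω v : E) : inner ℂ Ω v • Ω + rest Ω v = v := by
  rw [rest, add_sub_cancel]

theorem norm_inner_sq_add_norm_rest_sq {Ω : E} (hΩ : ‖Ω‖ = 1) (v : E) :
    ‖inner ℂ Ω v‖ ^ 2 + ‖rest Ω v‖ ^ 2 = ‖v‖ ^ 2 := by
  have h := norm_add_sq_eq_norm_sq_add_norm_sq_of_inner_eq_zero (𝕜 := ℂ)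
    (inner ℂ Ω v • Ω) (rest Ω v) (by rw [inner_smul_left, inner_rest hΩ, mul_zero])
  rw [smul_add_rest, norm_smul, hΩ, mul_one] at h
  nlinarith

theorem norm_rest_le {Ω : E} (hΩ : ‖Ω‖ = 1) (v : E) : ‖rest Ω v‖ ≤ ‖v‖ := by
  refine le_of_sq_le_sq ?_ (norm_nonneg _)
  rw [← norm_inner_sq_add_norm_rest_sq hΩ v]
  nlinarith [sq_nonneg ‖inner ℂ Ω v‖]

theorem norm_rest_comm {Ω Ω' : E} (hΩ : ‖Ω‖ = 1) (hΩ' : ‖Ω'‖ = 1) :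
    ‖rest Ω Ω'‖ = ‖rest Ω' Ω‖ := by
  have h1 := norm_inner_sq_add_norm_rest_sq hΩ Ω'
  have h2 := norm_inner_sq_add_norm_rest_sq hΩ' Ω
  rw [hΩ'] at h1
  rw [hΩ, norm_inner_symm] at h2
  exact (sq_eq_sq₀ (norm_nonneg _) (norm_nonneg _)).mp (by linarith)

theorem norm_inner_mul_sub_le {Ω Ω' : E} (hΩ : ‖Ω‖ = 1) (hΩ' : ‖Ω'‖ = 1) (v : E) :
    ‖inner ℂ Ω v‖ * ‖inner ℂ Ω' Ω‖ - ‖rest Ω v‖ * ‖rest Ω' Ω‖ ≤ ‖inner ℂ Ω' v‖ := by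
  have h1 : inner ℂ Ω' v = inner ℂ Ω v * inner ℂ Ω' Ω + inner ℂ Ω' (rest Ω v) := by
    conv_lhs => rw [← smul_add_rest Ω v]
    rw [inner_add_right, inner_smul_right]
  have h2 : inner ℂ Ω' (rest Ω v) = inner ℂ (rest Ω Ω') (rest Ω v) := by
    conv_lhs => rw [← smul_add_rest Ω Ω']
    rw [inner_add_left, inner_smul_left, inner_rest hΩ, mul_zero, zero_add]
  have h3 := norm_inner_le_norm (𝕜 := ℂ) (rest Ω Ω') (rest Ω v)
  rw [← h2, norm_rest_comm hΩ hΩ'] at h3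
  have h4 := norm_sub_le (inner ℂ Ω' v) (inner ℂ Ω' (rest Ω v))
  rw [h1, add_sub_cancel_right, norm_mul, ← h1] at h4
  linarith

theorem norm_rest_le_add {Ω Ω' : E} (hΩ' : ‖Ω'‖ = 1) (v : E) :
    ‖rest Ω' v‖ ≤ ‖inner ℂ Ω v‖ * ‖rest Ω' Ω‖ + ‖rest Ω v‖ := by
  have h1 : rest Ω' v = inner ℂ Ω v • rest Ω' Ω + rest Ω' (rest Ω v) := by
    conv_lhs => rw [← smul_add_rest Ω v]
    simp only [rest, inner_add_right, inner_smul_right, inner_sub_right, smul_sub, smul_smul,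
      add_smul, sub_smul]
    abel
  rw [h1]
  refine (norm_add_le _ _).trans ?_
  rw [norm_smul]
  gcongr
  exact norm_rest_le hΩ' _

end Rest

/-! ### Perturbation of the ground state -/

section Perturbation

variable {ι : Type*} [Fintype ι] [DecidableEq ι]

theorem mul_norm_sq_le_re_inner {H : Matrix ι ι ℂ} (hH : H.IsHermitian) {m : ℝ}
    {z : EuclideanSpace ℂ ι}
    (hm : ∀ k, inner ℂ (hH.eigenvectorBasis k) z ≠ 0 → m ≤ hH.eigenvalues k) :
    m * ‖z‖ ^ 2 ≤ (inner ℂ z (Matrix.toEuclideanLin H z)).re := by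
  set B := hH.eigenvectorBasis
  rw [← B.sum_inner_mul_inner, ← B.sum_sq_norm_inner_right, Complex.re_sum, Finset.mul_sum]
  refine Finset.sum_le_sum fun k _ => ?_
  rw [toEuclideanLin_eq_diagOp hH, inner_diagOp]
  have h1 : inner ℂ z (B k) * ((hH.eigenvalues k : ℂ) * inner ℂ (B k) z) =
      ((hH.eigenvalues k * ‖inner ℂ (B k) z‖ ^ 2 : ℝ) : ℂ) := by
    rw [← inner_conj_symm z (B k)]
    push_cast
    rw [← Complex.conj_mul']
    ring
  rw [h1, Complex.ofReal_re]
  by_cases hk : inner ℂ (B k) z = 0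
  · simp [hk]
  · have := hm k hk
    gcongr

/-- The sine of the angle between the ground states of two nearby Hamiltonians. The component `z` of
`Ω` orthogonal to `Ω'` has energy at least `E₀' + Δ` for `H'`, while `Ω` is an eigenvector of `H'`
up to an error `δ` with `E₀ ≤ E₀' + δ`. -/
theorem norm_rest_groundState_le {H H' : Matrix ι ι ℂ} (hH : H.IsHermitian)
    (hH' : H'.IsHermitian) {E₀ E₀' Δ δ : ℝ} {Ω Ω' : EuclideanSpace ℂ ι}
    (hΩ : IsNondegenerateGroundState H E₀ Ω) (hΩ' : IsNondegenerateGroundState H' E₀' Ω')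
    (hgap : SpectralGapGE H' E₀' Δ) (hδ : ‖H' - H‖ ≤ δ) (hδΔ : δ < Δ) :
    ‖rest Ω' Ω‖ ≤ δ / (Δ - δ) := by
  set z := rest Ω' Ω with hz
  have hz0 : inner ℂ Ω' z = 0 := inner_rest hΩ'.norm_eq_one Ω
  have hz0' : inner ℂ z Ω' = 0 := by rw [← inner_conj_symm, hz0, map_zero]
  have hzΩ : inner ℂ z Ω = (‖z‖ : ℂ) ^ 2 := by
    have h1 : inner ℂ z Ω = inner ℂ z (inner ℂ Ω' Ω • Ω' + z) := by
      rw [hz, smul_add_rest]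
    rw [h1, inner_add_right, inner_smul_right, hz0', mul_zero, zero_add,
      inner_self_eq_norm_sq_to_K]
    rfl
  have hdiff : ∀ x, Matrix.toEuclideanLin H' x =
      Matrix.toEuclideanLin H x + Matrix.toEuclideanLin (H' - H) x := fun x => by
    rw [map_sub, LinearMap.sub_apply, add_sub_cancel]
  have hpert : ∀ x y : EuclideanSpace ℂ ι, ‖inner ℂ x (Matrix.toEuclideanLin (H' - H) y)‖ ≤
      δ * (‖x‖ * ‖y‖) := fun x y => by
    have h1 := norm_inner_le_norm (𝕜 := ℂ) x (Matrix.toEuclideanLin (H' - H) y)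
    have h2 := norm_toEuclideanLin_le (H' - H) y
    calc _ ≤ ‖x‖ * (‖H' - H‖ * ‖y‖) := h1.trans (by gcongr)
      _ ≤ ‖x‖ * (δ * ‖y‖) := by gcongr
      _ = _ := by ring
  have henergy : E₀ - E₀' ≤ δ := by
    have h1 := mul_norm_sq_le_re_inner hH (z := Ω')
      fun k _ => hΩ.minimal _ (hasEigenvalue_eigenvalues hH k)
    have h2 := hdiff Ω'
    rw [hΩ'.eigenvector] at h2
    rw [← sub_eq_iff_eq_add] at h2
    have h3 := hpert Ω' Ω'
    have h4 := (abs_le.mp (Complex.abs_re_le_norm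
      (inner ℂ Ω' (Matrix.toEuclideanLin (H' - H) Ω')))).1
    rw [← h2, inner_sub_right, inner_smul_right, inner_self_eq_norm_sq_to_K, hΩ'.norm_eq_one,
      Complex.sub_re] at h1
    rw [hΩ'.norm_eq_one] at h3
    generalize Matrix.toEuclideanLin (H' - H) Ω' = P at h1 h3 h4
    simp at h1
    linarith
  have hlow := mul_norm_sq_le_re_inner hH' (m := E₀' + Δ) (z := z) fun k hk => by
    have := hΩ'.gap_le hgap hH' hz0 hk
    linarith
  have hexp : inner ℂ z (Matrix.toEuclideanLin H' z) =
      (E₀ : ℂ) * (‖z‖ : ℂ) ^ 2 + inner ℂ z (Matrix.toEuclideanLin (H' - H) Ω) := by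
    have h1 : Matrix.toEuclideanLin H' z = Matrix.toEuclideanLin H' Ω -
        inner ℂ Ω' Ω • (E₀' : ℂ) • Ω' := by
      rw [← hΩ'.eigenvector, ← map_smul, ← map_sub]
      rfl
    rw [h1, hdiff, hΩ.eigenvector]
    simp only [inner_sub_right, inner_add_right, inner_smul_right, hz0', hzΩ, mul_zero, sub_zero]
  have h4 := (Complex.abs_re_le_norm _).trans (hpert z Ω)
  rw [hΩ.norm_eq_one, mul_one] at h4
  rw [hexp, Complex.add_re] at hlow
  have h5 : ((E₀ : ℂ) * (‖z‖ : ℂ) ^ 2).re = E₀ * ‖z‖ ^ 2 := by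
    rw [← Complex.ofReal_pow, ← Complex.ofReal_mul, Complex.ofReal_re]
  rw [h5] at hlow
  have h6 := (abs_le.mp h4).2
  rw [le_div_iff₀ (by linarith)]
  rcases (norm_nonneg z).eq_or_lt with h0 | h0
  · rw [← h0, zero_mul]
    exact (norm_nonneg _).trans hδ
  · refine le_of_mul_le_mul_right ?_ h0
    have h7 : (E₀ - E₀') * ‖z‖ ^ 2 ≤ δ * ‖z‖ ^ 2 := by gcongr
    nlinarith

end Perturbation

/-! ### Following the ground state along the path -/

section Path

/-- One step along the path: the amplitude `A` along the ground state and the norm `W` of the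
remainder change to `A'` and `W'` when the ground state is rotated by an angle with sine `s` and
cosine `c`. The loss in `A ^ 2 - W ^ 2` is of second order in the angle because the next
projection reduces `W'` by a factor of four. -/
theorem amplitude_step {A W A' W' s c σ : ℝ} (hA : 0 ≤ A) (hW : 0 ≤ W) (hs : 0 ≤ s) (hc : 0 ≤ c)
    (hA' : 0 ≤ A') (hcs : c ^ 2 + s ^ 2 = 1) (hsσ : s ^ 2 ≤ σ) (hσ : σ ≤ 1 / 14)
    (hWA : W ≤ A / 4) (h1 : A * c - W * s ≤ A') (h2 : A' ^ 2 + W' ^ 2 = A ^ 2 + W ^ 2)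
    (h3 : W' ≤ A * s + W) :
    W' ≤ 3 / 5 * A' ∧ (1 - 5 / 2 * σ) * (A ^ 2 - W ^ 2) ≤ A' ^ 2 - (W' / 4) ^ 2 := by
  have hs1 : s ≤ 67 / 250 := by nlinarith
  have hc1 : 24 / 25 ≤ c := by nlinarith
  have hc2 : c ^ 2 ≤ 1 := by nlinarith
  constructor
  · have h4 : A * s ≤ A * (67 / 250) := by gcongr
    have h5 : A * (24 / 25) ≤ A * c := by gcongr
    have h6 : W * s ≤ A / 4 * (67 / 250) := by gcongr
    nlinarith
  · have h6 : W * s ≤ A * c := by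
      calc W * s ≤ A / 4 * (67 / 250) := by gcongr
        _ ≤ A * (24 / 25) := by linarith
        _ ≤ A * c := by gcongr
    have h7 : (A * c - W * s) ^ 2 ≤ A' ^ 2 := by
      have : 0 ≤ A * c - W * s := by linarith
      gcongr
    have hAW : 0 ≤ A ^ 2 - W ^ 2 := by nlinarith
    have h8 : (1 - 5 / 2 * σ) * (A ^ 2 - W ^ 2) ≤ (1 - 5 / 2 * s ^ 2) * (A ^ 2 - W ^ 2) := by
      gcongr
    -- the remaining inequality is a quadratic form in `s A` and `W` of negative discriminant
    have h9 : 0 ≤ 23 / 16 * (s * A) ^ 2 - 17 / 8 * (s * A) * (c * W) +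
        (15 / 16 - 23 / 16 * s ^ 2) * W ^ 2 := by
      have h10 : (15 / 16 - 23 / 16 * (1 / 14)) * W ^ 2 ≤
          (15 / 16 - 23 / 16 * s ^ 2) * W ^ 2 := by
        gcongr
        linarith
      have h11 : c ^ 2 * W ^ 2 ≤ 1 * W ^ 2 := by gcongr
      nlinarith [sq_nonneg (23 / 16 * (s * A) - 17 / 16 * (c * W))]
    nlinarith

variable {a b : Type*} [Fintype a] [DecidableEq a] [Fintype b] [DecidableEq b]
  {HA : Matrix a a ℂ} {HB : Matrix b b ℂ} {V : ℝ → Matrix (a × b) (a × b) ℂ}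
  {Ω : ℝ → EuclideanSpace ℂ (a × b)} {Δ g c₀ : ℝ}

theorem IsBoundaryAdiabaticPath.norm_eq_one (h : IsBoundaryAdiabaticPath HA HB V Ω Δ g c₀)
    {ν : ℝ} (hν : ν ∈ Set.Icc (0 : ℝ) 1) : ‖Ω ν‖ = 1 := by
  obtain ⟨E₀, hE, -⟩ := h.gapped ν hν
  exact hE.norm_eq_one

theorem IsBoundaryAdiabaticPath.nonneg (h : IsBoundaryAdiabaticPath HA HB V Ω Δ g c₀) :
    0 ≤ c₀ * g :=
  (norm_nonneg _).trans ((le_max_left _ _).trans (h.deriv_le 0 (by simp)))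

theorem IsBoundaryAdiabaticPath.norm_rest_path_le (h : IsBoundaryAdiabaticPath HA HB V Ω Δ g c₀)
    {ν ν' δ : ℝ} (hν : ν ∈ Set.Icc (0 : ℝ) 1) (hν' : ν' ∈ Set.Icc (0 : ℝ) 1)
    (hδ : c₀ * g * |ν' - ν| ≤ δ) (hδΔ : δ < Δ) : ‖rest (Ω ν') (Ω ν)‖ ≤ δ / (Δ - δ) := by
  obtain ⟨E₀, hE, -⟩ := h.gapped ν hν
  obtain ⟨E₀', hE', hgap⟩ := h.gapped ν' hν'
  refine norm_rest_groundState_le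
    (isHermitian_hamiltonian h.hermitian_A h.hermitian_B (h.hermitian_V ν hν))
    (isHermitian_hamiltonian h.hermitian_A h.hermitian_B (h.hermitian_V ν' hν')) hE hE' hgap ?_ hδΔ
  have h1 := Convex.norm_image_sub_le_of_norm_derivWithin_le h.differentiable
    (fun μ hμ => (le_max_left _ _).trans (h.deriv_le μ hμ)) (convex_Icc 0 1) hν hν'
  have h2 : hamiltonian HA HB (V ν') - hamiltonian HA HB (V ν) = V ν' - V ν := by
    unfold hamiltonian
    abel
  rw [h2]
  exact h1.trans hδ

/-- The approximate ground state projection at a point of the path, in terms of the amplitude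
along the ground state and the norm of the remainder. -/
theorem IsBoundaryAdiabaticPath.exists_project (h : IsBoundaryAdiabaticPath HA HB V Ω Δ g c₀)
    (hΔ : 0 < Δ) (hg : 0 ≤ g) {ν : ℝ} (hν : ν ∈ Set.Icc (0 : ℝ) 1) {T : ℝ} (hT : 0 ≤ T)
    (v : EuclideanSpace ℂ (a × b)) :
    ∃ u, inner ℂ (Ω ν) u = inner ℂ (Ω ν) v ∧
      ‖rest (Ω ν) u‖ ≤ 5 * Real.exp (-(T * Δ / 2)) * ‖rest (Ω ν) v‖ ∧
      productNorm a b u ≤ Real.exp (g * T) * productNorm a b v := by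
  obtain ⟨E₀, hE, hgap⟩ := h.gapped ν hν
  obtain ⟨K, hK1, hK2, hK3⟩ := exists_approx_groundState_projection h.hermitian_A h.hermitian_B
    (h.hermitian_V ν hν) hg (h.seStrength_le ν hν) hE hΔ hgap hT
  obtain ⟨h1, h2⟩ := hK2 _ (inner_rest hE.norm_eq_one v)
  have h3 : K v = inner ℂ (Ω ν) v • Ω ν + K (rest (Ω ν) v) := by
    conv_lhs => rw [← smul_add_rest (Ω ν) v]
    rw [map_add, map_smul, hK1]
  have h4 : inner ℂ (Ω ν) (K v) = inner ℂ (Ω ν) v := by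
    rw [h3, inner_add_right, h1, inner_smul_right, inner_self_eq_norm_sq_to_K, hE.norm_eq_one]
    simp
  have h5 : rest (Ω ν) (K v) = K (rest (Ω ν) v) := by
    rw [rest, h4, h3, add_sub_cancel_left]
  exact ⟨K v, h4, h5 ▸ h2, hK3 v⟩

theorem five_mul_exp_neg_three_le : 5 * Real.exp (-3) ≤ 1 / 4 := by
  have h1 : (2.718 : ℝ) ^ 3 ≤ Real.exp 1 ^ 3 := by
    gcongr
    exact (lt_trans (by norm_num) Real.exp_one_gt_d9).le
  rw [← Real.exp_nat_mul] at h1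
  norm_num at h1
  rw [Real.exp_neg, ← div_eq_mul_inv, div_le_div_iff₀ (Real.exp_pos _) (by norm_num)]
  linarith

/-- Projecting the product state with the largest overlap for a time `(S₀ + 6) / Δ` suppresses
the remainder to a quarter of the overlap. -/
theorem IsBoundaryAdiabaticPath.exists_initial (h : IsBoundaryAdiabaticPath HA HB V Ω Δ g c₀)
    (hΔ : 0 < Δ) (hg : 0 ≤ g) :
    ∃ v, ‖rest (Ω 0) v‖ ≤ ‖inner ℂ (Ω 0) v‖ / 4 ∧
      ‖inner ℂ (Ω 0) v‖ ^ 2 = Real.exp (-renyiInfEntropy (Ω 0)) ∧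
      productNorm a b v ≤ Real.exp (g / Δ * (renyiInfEntropy (Ω 0) + 6)) := by
  have h0 : (0 : ℝ) ∈ Set.Icc (0 : ℝ) 1 := by simp
  obtain ⟨φ, χ, hφ, hχ, hS, hov⟩ := exists_productState_inner_eq (h.norm_eq_one h0)
  set S := renyiInfEntropy (Ω 0)
  have hnorm : ‖productState φ χ‖ = 1 := by rw [norm_productState, hφ, hχ, one_mul]
  obtain ⟨u, hu1, hu2, hu3⟩ := h.exists_project hΔ hg h0 (T := (S + 6) / Δ) (by positivity)
    (productState φ χ)
  refine ⟨u, ?_, ?_, ?_⟩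
  · rw [hu1, hov]
    refine hu2.trans ?_
    have h1 := norm_rest_le (h.norm_eq_one h0) (productState φ χ)
    rw [hnorm] at h1
    have h2 : Real.exp (-((S + 6) / Δ * Δ / 2)) = Real.exp (-3) * Real.exp (-S / 2) := by
      rw [div_mul_cancel₀ _ hΔ.ne', ← Real.exp_add]
      ring_nf
    rw [h2]
    have h3 := five_mul_exp_neg_three_le
    calc _ ≤ 5 * (Real.exp (-3) * Real.exp (-S / 2)) * 1 := by gcongr
      _ = 5 * Real.exp (-3) * Real.exp (-S / 2) := by ring
      _ ≤ 1 / 4 * Real.exp (-S / 2) := by gcongr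
      _ = _ := by ring
  · rw [hu1, hov, ← Real.exp_nat_mul]
    congr 1
    push_cast
    ring
  · refine hu3.trans ?_
    have h1 := productNorm_productState_le φ χ
    rw [hφ, hχ, one_mul] at h1
    calc _ ≤ Real.exp (g * ((S + 6) / Δ)) * 1 := by gcongr
      _ = _ := by rw [mul_one]; ring_nf

/-- The state after `k` of `N` steps along the path, with an approximate ground state projection
for a time `6 / Δ` after each step. -/
theorem IsBoundaryAdiabaticPath.exists_follow (h : IsBoundaryAdiabaticPath HA HB V Ω Δ g c₀)
    (hΔ : 0 < Δ) (hg : 0 ≤ g) {N : ℕ} {σ : ℝ} (hσ : σ ≤ 1 / 14)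
    (hstep : ∀ k : ℕ, k < N → ‖rest (Ω ((k + 1 : ℕ) / N)) (Ω (k / N))‖ ^ 2 ≤ σ) (k : ℕ)
    (hk : k < N) :
    ∃ v, ‖rest (Ω (k / N)) v‖ ≤ ‖inner ℂ (Ω (k / N)) v‖ / 4 ∧
      15 / 16 * Real.exp (-renyiInfEntropy (Ω 0)) * (1 - 5 / 2 * σ) ^ k ≤
        ‖inner ℂ (Ω (k / N)) v‖ ^ 2 - ‖rest (Ω (k / N)) v‖ ^ 2 ∧
      productNorm a b v ≤ Real.exp (g / Δ * (renyiInfEntropy (Ω 0) + 6 + 6 * k)) := by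
  induction k with
  | zero =>
    obtain ⟨v, h1, h2, h3⟩ := h.exists_initial hΔ hg
    refine ⟨v, by simpa using h1, ?_, by simpa using h3⟩
    simp only [Nat.cast_zero, zero_div, pow_zero, mul_one]
    rw [← h2]
    nlinarith [norm_nonneg (rest (Ω 0) v)]
  | succ k ih =>
    obtain ⟨v, h1, h2, h3⟩ := ih (by omega)
    have hN : (0 : ℝ) < N := by exact_mod_cast (by omega : 0 < N)
    have mem : ∀ j : ℕ, j ≤ N → (j / N : ℝ) ∈ Set.Icc (0 : ℝ) 1 := fun j hj =>
      ⟨by positivity, by rw [div_le_one hN]; exact_mod_cast hj⟩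
    have hu := h.norm_eq_one (mem k (by omega))
    have hu' := h.norm_eq_one (mem (k + 1) (by omega))
    have hcs := norm_inner_sq_add_norm_rest_sq hu' (Ω (k / N))
    rw [hu, one_pow] at hcs
    obtain ⟨hW, hloss⟩ := amplitude_step (norm_nonneg (inner ℂ (Ω (k / N)) v))
      (norm_nonneg (rest (Ω (k / N)) v)) (norm_nonneg _) (norm_nonneg _) (norm_nonneg _) hcs
      (hstep k (by omega)) hσ h1 (norm_inner_mul_sub_le hu hu' v)
      ((norm_inner_sq_add_norm_rest_sq hu' v).trans (norm_inner_sq_add_norm_rest_sq hu v).symm)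
      (norm_rest_le_add hu' v)
    obtain ⟨u, hu1, hu2, hu3⟩ := h.exists_project hΔ hg (mem (k + 1) (by omega)) (T := 6 / Δ)
      (by positivity) v
    have h6 : -(6 / Δ * Δ / 2) = -3 := by rw [div_mul_cancel₀ _ hΔ.ne']; norm_num
    rw [h6] at hu2
    have hu4 : ‖rest (Ω ((k + 1 : ℕ) / N)) u‖ ≤ ‖rest (Ω ((k + 1 : ℕ) / N)) v‖ / 4 := by
      refine hu2.trans ?_
      have := mul_le_mul_of_nonneg_right five_mul_exp_neg_three_le
        (norm_nonneg (rest (Ω ((k + 1 : ℕ) / N)) v))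
      linarith
    refine ⟨u, ?_, ?_, ?_⟩
    · rw [hu1]
      linarith [norm_nonneg (inner ℂ (Ω ((k + 1 : ℕ) / N)) v)]
    · rw [hu1]
      have h7 : ‖rest (Ω ((k + 1 : ℕ) / N)) u‖ ^ 2 ≤ (‖rest (Ω ((k + 1 : ℕ) / N)) v‖ / 4) ^ 2 := by
        gcongr
      have h8 := mul_le_mul_of_nonneg_left h2 (by linarith : (0 : ℝ) ≤ 1 - 5 / 2 * σ)
      rw [pow_succ]
      linarith
    · refine hu3.trans ?_
      calc _ ≤ Real.exp (g * (6 / Δ)) *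
            Real.exp (g / Δ * (renyiInfEntropy (Ω 0) + 6 + 6 * k)) := by gcongr
        _ = _ := by
          rw [← Real.exp_add]
          push_cast
          ring_nf

/-- At the end of the path there is a vector of controlled projective norm whose direction is
close to the ground state. With `x = c₀ g / Δ`, the path is divided into
`N = ⌈x + 7 x ^ 2 / 2⌉ + 1` steps, so that the total second-order loss stays bounded. -/
theorem IsBoundaryAdiabaticPath.exists_final (h : IsBoundaryAdiabaticPath HA HB V Ω Δ g c₀)
    (hΔ : 0 < Δ) (hg : 0 ≤ g) :
    ∃ v, ‖rest (Ω 1) v‖ ≤ 3 / 5 * ‖inner ℂ (Ω 1) v‖ ∧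
      5 / 32 * Real.exp (-renyiInfEntropy (Ω 0)) ≤ ‖inner ℂ (Ω 1) v‖ ^ 2 ∧
      productNorm a b v ≤ Real.exp (g / Δ * (renyiInfEntropy (Ω 0) + 12 + 6 * (c₀ * g / Δ) +
        21 * (c₀ * g / Δ) ^ 2)) := by
  set x := c₀ * g / Δ with hx
  have hx0 : 0 ≤ x := div_nonneg h.nonneg hΔ.le
  set M := ⌈x + 7 / 2 * x ^ 2⌉₊ with hM
  have hM1 : x + 7 / 2 * x ^ 2 ≤ M := Nat.le_ceil _
  have hM2 : (M : ℝ) < x + 7 / 2 * x ^ 2 + 1 := Nat.ceil_lt_add_one (by positivity)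
  set N := M + 1 with hN
  have hNM : (N : ℝ) = M + 1 := by rw [hN]; push_cast; rfl
  have hNx : 0 < (N : ℝ) - x := by rw [hNM]; nlinarith [sq_nonneg x]
  have hN0 : (0 : ℝ) < N := by linarith
  set s := x / (N - x) with hs
  have hs0 : 0 ≤ s := div_nonneg hx0 hNx.le
  have hσ : s ^ 2 ≤ 1 / 14 := by
    rw [hs, div_pow, div_le_div_iff₀ (by positivity) (by norm_num)]
    have h1 : 1 + 7 / 2 * x ^ 2 ≤ N - x := by rw [hNM]; linarith
    have h2 : (1 + 7 / 2 * x ^ 2) ^ 2 ≤ (N - x) ^ 2 := by gcongr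
    nlinarith [sq_nonneg (1 - 7 / 2 * x ^ 2)]
  -- the left side decreases in `N`, and `d ≥ 0` is the excess over the smallest admissible `N`
  have hNσ : N * s ^ 2 ≤ 1 / 3 := by
    rw [hs, div_pow, mul_div_assoc', div_le_div_iff₀ (by positivity) (by norm_num)]
    obtain ⟨d, hd⟩ : ∃ d : ℝ, N - x = 1 + 7 / 2 * x ^ 2 + d := ⟨_, (add_sub_cancel _ _).symm⟩
    have hd0 : 0 ≤ d := by rw [hNM] at hd; linarith
    have hNd : (N : ℝ) = 1 + 7 / 2 * x ^ 2 + d + x := by linarith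
    rw [hd, hNd]
    have h1 : 0 ≤ x ^ 2 * (4 - 3 * x + 7 / 4 * x ^ 2) := by
      have : 0 ≤ 4 - 3 * x + 7 / 4 * x ^ 2 := by nlinarith [sq_nonneg (7 / 4 * x - 3 / 2)]
      positivity
    have h2 : 0 ≤ x ^ 2 * d := by positivity
    nlinarith [sq_nonneg d]
  have mem : ∀ j : ℕ, j ≤ N → (j / N : ℝ) ∈ Set.Icc (0 : ℝ) 1 := fun j hj =>
    ⟨by positivity, by rw [div_le_one hN0]; exact_mod_cast hj⟩
  have hstep : ∀ k : ℕ, k < N → ‖rest (Ω ((k + 1 : ℕ) / N)) (Ω (k / N))‖ ^ 2 ≤ s ^ 2 := by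
    intro k hk
    have h1 : c₀ * g * |((k + 1 : ℕ) / N : ℝ) - k / N| ≤ x / N * Δ := by
      have h2 : ((k + 1 : ℕ) / N : ℝ) - k / N = 1 / N := by
        push_cast
        ring
      rw [h2, abs_of_pos (by positivity), hx]
      apply le_of_eq
      field_simp
    have hlt : x / N * Δ < Δ := by
      have : x / N < 1 := by rw [div_lt_one hN0]; linarith
      nlinarith
    have h3 := h.norm_rest_path_le (mem k (by omega)) (mem (k + 1) (by omega)) h1 hlt
    have h4 : x / N * Δ / (Δ - x / N * Δ) = s := by
      rw [hs]
      have : Δ - x / N * Δ = (N - x) * (Δ / N) := by field_simp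
      rw [this]
      field_simp
    rw [h4] at h3
    gcongr
  obtain ⟨v, h1, h2, h3⟩ := h.exists_follow hΔ hg hσ hstep M (by omega)
  have hone : ((M + 1 : ℕ) / N : ℝ) = 1 := by rw [← hN, div_self hN0.ne']
  have hu := h.norm_eq_one (mem M (by omega))
  have hu' := h.norm_eq_one (ν := 1) (by simp)
  have hlast := hstep M (by omega)
  rw [hone] at hlast
  have hcs := norm_inner_sq_add_norm_rest_sq hu' (Ω (M / N))
  rw [hu, one_pow] at hcs
  obtain ⟨hW, hloss⟩ := amplitude_step (norm_nonneg (inner ℂ (Ω (M / N)) v))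
    (norm_nonneg (rest (Ω (M / N)) v)) (norm_nonneg _) (norm_nonneg _) (norm_nonneg _) hcs
    hlast hσ h1 (norm_inner_mul_sub_le hu hu' v)
    ((norm_inner_sq_add_norm_rest_sq hu' v).trans (norm_inner_sq_add_norm_rest_sq hu v).symm)
    (norm_rest_le_add hu' v)
  refine ⟨v, hW, ?_, h3.trans ?_⟩
  · set S := Real.exp (-renyiInfEntropy (Ω 0))
    have hS : 0 < S := Real.exp_pos _
    have h4 : 1 / 6 ≤ (1 - 5 / 2 * s ^ 2) ^ N := by
      have h5 := one_add_mul_le_pow (a := -(5 / 2 * s ^ 2)) (by linarith) N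
      rw [← sub_eq_add_neg] at h5
      linarith
    have h6 := mul_le_mul_of_nonneg_left h2 (by linarith : (0 : ℝ) ≤ 1 - 5 / 2 * s ^ 2)
    have h7 : 15 / 16 * S * (1 / 6) ≤ 15 / 16 * S * (1 - 5 / 2 * s ^ 2) ^ N := by gcongr
    rw [hN, pow_succ] at h7
    nlinarith [sq_nonneg (‖rest (Ω 1) v‖ / 4)]
  · rw [Real.exp_le_exp]
    exact mul_le_mul_of_nonneg_left (by linarith) (by positivity)

end Path

/-! ### Approximation of the final ground state -/

section Approximation

theorem kappa_pos {Δ g : ℝ} (hΔ : 0 < Δ) (hg : 0 < g) : 0 < kappa Δ g := by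
  unfold kappa
  positivity

/-- The exponent of `errorConst` absorbs the overlap `e^{-S / 2}` and the projective norm
`e^L` accumulated along the path. -/
theorem twelve_mul_exp_le_errorConst {Δ g c₀ S : ℝ} (hΔ : 0 < Δ) (hg : 0 < g) (hc : 0 ≤ c₀ * g)
    (hS : 0 ≤ S) :
    12 * Real.exp (S / 2 + 2 * kappa Δ g *
      (g / Δ * (S + 12 + 6 * (c₀ * g / Δ) + 21 * (c₀ * g / Δ) ^ 2))) ≤ errorConst Δ g c₀ S := by
  set r := g / Δ with hr
  set x := c₀ * g / Δ with hx
  have hr0 : 0 < r := div_pos hg hΔ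
  have hx0 : 0 ≤ x := div_nonneg hc hΔ.le
  have hκ : 2 * kappa Δ g = (1 + 2 * r)⁻¹ := by
    rw [kappa, hr]
    field_simp
    ring
  have hκ' : (S + 3) / (4 * kappa Δ g) = (S + 3) * (1 + 2 * r) / 2 := by
    have : 4 * kappa Δ g = 2 * (1 + 2 * r)⁻¹ := by rw [← hκ]; ring
    rw [this]
    field_simp
  have hpath : 3 * c₀ * g ^ 3 * (2 * Δ / g + 7 * c₀) / Δ ^ 3 = 6 * r * x + 21 * r * x ^ 2 := by
    rw [hr, hx]
    field_simp
    ring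
  have hexp : errorConst Δ g c₀ S =
      12 * Real.exp ((S + 3) * (1 + 2 * r) / 2 + (6 * r * x + 21 * r * x ^ 2)) := by
    rw [errorConst, hκ', hpath, add_right_comm, Real.exp_add _ (Real.log 12),
      Real.exp_log (by norm_num), mul_comm]
  rw [hexp, hκ]
  refine mul_le_mul_of_nonneg_left (Real.exp_le_exp.mpr ?_) (by norm_num)
  -- the overhead `12 r / (1 + 2 r)` is at most `3 / 2 + 3 r` because `6 (r - 1 / 2) ^ 2 ≥ 0`
  have h1 : (1 + 2 * r)⁻¹ * (r * (S + 12 + 6 * x + 21 * x ^ 2)) ≤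
      S * r + 6 * r * x + 21 * r * x ^ 2 + (3 / 2 + 3 * r) := by
    rw [inv_mul_le_iff₀ (by positivity)]
    have h2 : 0 ≤ r * (r * (S + 6 * x + 21 * x ^ 2)) := by positivity
    nlinarith [sq_nonneg (2 * r - 1)]
  linarith

variable {a b : Type*} [Fintype a] [DecidableEq a] [Fintype b]

theorem schmidtRank_productState_le (φ : EuclideanSpace ℂ a) (χ : EuclideanSpace ℂ b) :
    schmidtRank (productState φ χ) ≤ 1 := by
  simpa using schmidtRank_sum_productState_le (D := 1) (fun _ => φ) (fun _ => χ)

theorem exists_norm_eq_one_schmidtRank_le {Ω : EuclideanSpace ℂ (a × b)} (hΩ : ‖Ω‖ = 1) {D : ℕ}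
    (hD : 1 ≤ D) : ∃ ψ : EuclideanSpace ℂ (a × b), ‖ψ‖ = 1 ∧ schmidtRank ψ ≤ D ∧ ‖ψ - Ω‖ ≤ 2 := by
  obtain ⟨φ, χ, hφ, hχ, -⟩ := exists_productState_inner_eq hΩ
  have h1 : ‖productState φ χ‖ = 1 := by rw [norm_productState, hφ, hχ, one_mul]
  refine ⟨productState φ χ, h1, (schmidtRank_productState_le φ χ).trans hD, ?_⟩
  have := norm_sub_le (productState φ χ) Ω
  linarith

/-- Normalizing an approximation of a unit vector at most doubles the error. -/
theorem exists_normalized {Ω η : EuclideanSpace ℂ (a × b)} (hΩ : ‖Ω‖ = 1) {D : ℕ} (hD : 1 ≤ D)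
    (hη : schmidtRank η ≤ D) {ε : ℝ} (hε : ‖η - Ω‖ ≤ ε) :
    ∃ ψ : EuclideanSpace ℂ (a × b), ‖ψ‖ = 1 ∧ schmidtRank ψ ≤ D ∧ ‖ψ - Ω‖ ≤ 2 * ε := by
  rcases eq_or_ne η 0 with rfl | h0
  · obtain ⟨ψ, h1, h2, h3⟩ := exists_norm_eq_one_schmidtRank_le hΩ hD
    rw [zero_sub, norm_neg, hΩ] at hε
    exact ⟨ψ, h1, h2, by linarith⟩
  · have hpos : 0 < ‖η‖ := norm_pos_iff.mpr h0
    refine ⟨((‖η‖⁻¹ : ℝ) : ℂ) • η, ?_, (schmidtRank_smul_le _ _).trans hη, ?_⟩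
    · rw [norm_smul, Complex.norm_real, Real.norm_of_nonneg (by positivity),
        inv_mul_cancel₀ hpos.ne']
    · have h1 : ((‖η‖⁻¹ : ℝ) : ℂ) • η - Ω = ((‖η‖⁻¹ - 1 : ℝ) : ℂ) • η + (η - Ω) := by
        push_cast
        rw [sub_smul, one_smul]
        abel
      have h2 : ‖((‖η‖⁻¹ - 1 : ℝ) : ℂ) • η‖ = |1 - ‖η‖| := by
        rw [norm_smul, Complex.norm_real, Real.norm_eq_abs, ← abs_of_pos hpos, ← abs_mul,
          abs_of_pos hpos, sub_mul, inv_mul_cancel₀ hpos.ne', one_mul]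
      have h3 : |1 - ‖η‖| ≤ ‖η - Ω‖ := by
        rw [← hΩ, norm_sub_rev]
        exact abs_norm_sub_norm_le Ω η
      have h4 := norm_add_le (((‖η‖⁻¹ - 1 : ℝ) : ℂ) • η) (η - Ω)
      rw [h1]
      linarith

variable [DecidableEq b] {HA : Matrix a a ℂ} {HB : Matrix b b ℂ}
  {V : ℝ → Matrix (a × b) (a × b) ℂ} {Ω : ℝ → EuclideanSpace ℂ (a × b)} {Δ g c₀ : ℝ}

/-- The final ground state is approximated by states of bounded Schmidt rank. The time `T` of the
last projection balances its error `e^{-TΔ/2}` against the truncation error `e^{L + g T} / √D`. -/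
theorem IsBoundaryAdiabaticPath.exists_schmidtRank_le
    (h : IsBoundaryAdiabaticPath HA HB V Ω Δ g c₀) (hΔ : 0 < Δ) (hg : 0 < g) {D : ℕ} (hD : 1 ≤ D) :
    ∃ ψ : EuclideanSpace ℂ (a × b), ‖ψ‖ = 1 ∧ schmidtRank ψ ≤ D ∧
      ‖ψ - Ω 1‖ ≤ errorConst Δ g c₀ (renyiInfEntropy (Ω 0)) * (D : ℝ) ^ (-kappa Δ g) := by
  have h1 : (1 : ℝ) ∈ Set.Icc (0 : ℝ) 1 := by simp
  have hΩ := h.norm_eq_one h1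
  have hS := renyiInfEntropy_nonneg (h.norm_eq_one (ν := 0) (by simp))
  obtain ⟨v, hv1, hv2, hv3⟩ := h.exists_final hΔ hg.le
  have hconst := twelve_mul_exp_le_errorConst hΔ hg h.nonneg hS
  set S := renyiInfEntropy (Ω 0)
  set κ := kappa Δ g with hκ
  have hκ0 : 0 < κ := kappa_pos hΔ hg
  set L := g / Δ * (S + 12 + 6 * (c₀ * g / Δ) + 21 * (c₀ * g / Δ) ^ 2) with hL
  have hD0 : (0 : ℝ) < D := by exact_mod_cast hD
  have hrpow : (D : ℝ) ^ (-κ) = Real.exp (-(κ * Real.log D)) := by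
    rw [Real.rpow_def_of_pos hD0]
    ring_nf
  have hbound : 12 * Real.exp (S / 2) * Real.exp (2 * κ * L - κ * Real.log D) ≤
      errorConst Δ g c₀ S * (D : ℝ) ^ (-κ) := by
    rw [hrpow]
    calc _ = 12 * Real.exp (S / 2 + 2 * κ * L) * Real.exp (-(κ * Real.log D)) := by
          rw [mul_assoc 12, mul_assoc 12, ← Real.exp_add, ← Real.exp_add]
          ring_nf
      _ ≤ _ := by gcongr
  have hS1 : 1 ≤ Real.exp (S / 2) := Real.one_le_exp (by positivity)
  -- for `√D < e^L` the right side exceeds the diameter of the unit sphere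
  rcases lt_or_ge (Real.log D / 2) L with hlt | hge
  · obtain ⟨ψ, hψ1, hψ2, hψ3⟩ := exists_norm_eq_one_schmidtRank_le hΩ hD
    refine ⟨ψ, hψ1, hψ2, hψ3.trans (le_trans ?_ hbound)⟩
    have hq : 1 ≤ Real.exp (2 * κ * L - κ * Real.log D) := Real.one_le_exp (by nlinarith)
    nlinarith
  · set T := (Real.log D / 2 - L) / (Δ / 2 + g) with hT
    have hT0 : 0 ≤ T := div_nonneg (by linarith) (by positivity)
    set q := Real.exp (2 * κ * L - κ * Real.log D) with hq
    have hq0 : 0 < q := Real.exp_pos _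
    have hq1 : Real.exp (-(T * Δ / 2)) = q := by
      rw [hq, hκ, kappa, hT]
      congr 1
      field_simp
      ring
    have hq2 : Real.exp (g * T) * Real.exp L = q * √D := by
      have : √(D : ℝ) = Real.exp (Real.log D / 2) := by
        rw [Real.exp_half, Real.exp_log hD0]
      rw [← hq1, this, ← Real.exp_add, ← Real.exp_add]
      congr 1
      have : T * (Δ / 2 + g) = Real.log D / 2 - L := div_mul_cancel₀ _ (by positivity)
      linarith
    obtain ⟨u, hu1, hu2, hu3⟩ := h.exists_project hΔ hg.le h1 hT0 v
    -- the factor `11 / 10` only makes the inequality strict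
    have hu4 : productNorm a b u < 11 / 10 * (q * √D) := by
      have h2 : productNorm a b u ≤ q * √D := by
        rw [← hq2]
        exact hu3.trans (by gcongr)
      have h3 : 0 < q * √D := by positivity
      linarith
    obtain ⟨φ, hφ1, hφ2⟩ := exists_schmidtRank_le_norm_sub_le hu4 hD
    have hφ3 : ‖u - φ‖ ≤ 11 / 10 * q := by
      refine hφ2.trans (le_of_eq ?_)
      have : √(D : ℝ) ≠ 0 := by positivity
      field_simp
    set α := inner ℂ (Ω 1) v with hα
    have hA : 0 < ‖α‖ := by
      have : 0 < ‖α‖ ^ 2 := lt_of_lt_of_le (by positivity) hv2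
      exact norm_pos_iff.mpr fun h0 => by simp [h0] at this
    have hα0 : α ≠ 0 := norm_pos_iff.mp hA
    -- `64 / 25` slightly exceeds `√(32 / 5)`
    have hAinv : ‖α‖⁻¹ ≤ 64 / 25 * Real.exp (S / 2) := by
      rw [inv_le_iff_one_le_mul₀ hA]
      refine le_of_sq_le_sq ?_ (by positivity)
      have h2 : Real.exp (S / 2) ^ 2 * Real.exp (-S) = 1 := by
        rw [← Real.exp_nat_mul, ← Real.exp_add, ← Real.exp_zero]
        congr 1
        push_cast
        ring
      have h3 : Real.exp (S / 2) ^ 2 * (5 / 32 * Real.exp (-S)) ≤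
          Real.exp (S / 2) ^ 2 * ‖α‖ ^ 2 := by gcongr
      rw [mul_pow, mul_pow]
      linarith
    have herr : ‖α⁻¹ • φ - Ω 1‖ ≤ 6 * Real.exp (S / 2) * q := by
      have h2 : α⁻¹ • φ - Ω 1 = α⁻¹ • (rest (Ω 1) u - (u - φ)) := by
        rw [rest, hu1, sub_sub_sub_cancel_left, smul_sub, smul_smul, inv_mul_cancel₀ hα0,
          one_smul]
      have h3 := norm_sub_le (rest (Ω 1) u) (u - φ)
      rw [h2, norm_smul, norm_inv]
      have h4 : ‖rest (Ω 1) u‖ ≤ 3 * q * ‖α‖ := by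
        rw [hq1] at hu2
        calc _ ≤ 5 * q * (3 / 5 * ‖α‖) := hu2.trans (by gcongr)
          _ = _ := by ring
      calc ‖α‖⁻¹ * ‖rest (Ω 1) u - (u - φ)‖ ≤ ‖α‖⁻¹ * (3 * q * ‖α‖ + 11 / 10 * q) := by
            gcongr
            linarith
        _ = 3 * q + 11 / 10 * q * ‖α‖⁻¹ := by field_simp
        _ ≤ 3 * q + 11 / 10 * q * (64 / 25 * Real.exp (S / 2)) := by gcongr
        _ ≤ _ := by nlinarith
    obtain ⟨ψ, hψ1, hψ2, hψ3⟩ := exists_normalized hΩ hD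
      ((schmidtRank_smul_le α⁻¹ φ).trans hφ1) herr
    exact ⟨ψ, hψ1, hψ2, hψ3.trans (le_trans (le_of_eq (by ring)) hbound)⟩

end Approximation

/-! ### Low-rank approximation bounds the tail of the Schmidt spectrum -/

section Tail

/-- A maximum principle for the sum of the `D` largest values: weights in `[0, 1]` of total at
most `D` collect at most that sum. -/
theorem sum_mul_le_sum_of_antitone {d : ℕ} {p t : Fin d → ℝ} (hp : Antitone p) (hp0 : ∀ i, 0 ≤ p i)
    (ht0 : ∀ i, 0 ≤ t i) (ht1 : ∀ i, t i ≤ 1) {D : ℕ} (htD : ∑ i, t i ≤ D) :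
    ∑ i, p i * t i ≤ ∑ i : Fin d, if (i : ℕ) < D then p i else 0 := by
  rcases lt_or_ge D d with hD | hD
  · set m := p ⟨D, hD⟩ with hm
    have h1 : ∀ i : Fin d, p i * t i ≤ (if (i : ℕ) < D then p i - m else 0) + m * t i := by
      intro i
      split_ifs with hi
      · have : m ≤ p i := hp (Fin.le_def.mpr hi.le)
        nlinarith [ht1 i]
      · have : p i ≤ m := hp (Fin.le_def.mpr (not_lt.mp hi))
        nlinarith [ht0 i]
    have h2 : ∀ i : Fin d, (if (i : ℕ) < D then p i - m else 0) =
        (if (i : ℕ) < D then p i else 0) - m * (if (i : ℕ) < D then 1 else 0) := by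
      intro i
      split_ifs <;> simp
    have h3 : ∑ i : Fin d, (if (i : ℕ) < D then (1 : ℝ) else 0) = D := by
      rw [Finset.sum_boole, Fin.card_filter_val_lt, min_eq_right hD.le]
    refine (Finset.sum_le_sum fun i _ => h1 i).trans ?_
    rw [Finset.sum_add_distrib, ← Finset.mul_sum]
    simp_rw [h2]
    rw [Finset.sum_sub_distrib, ← Finset.mul_sum, h3]
    have : m * ∑ i, t i ≤ m * D := mul_le_mul_of_nonneg_left htD (hp0 _)
    linarith
  · refine Finset.sum_le_sum fun i _ => ?_
    rw [if_pos (i.2.trans_le hD)]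
    nlinarith [ht1 i, hp0 i]

variable {a b : Type*} [Fintype a] [Fintype b]

/-- The column `j` of the coefficient matrix of `ψ`. -/
noncomputable def column (ψ : EuclideanSpace ℂ (a × b)) (j : b) : EuclideanSpace ℂ a :=
  WithLp.toLp 2 fun i => ψ (i, j)

theorem sum_norm_column_sq (ψ : EuclideanSpace ℂ (a × b)) :
    ∑ j, ‖column ψ j‖ ^ 2 = ‖ψ‖ ^ 2 := by
  simp_rw [EuclideanSpace.norm_sq_eq]
  rw [Fintype.sum_prod_type_right]
  rfl

variable [DecidableEq a]

theorem sum_norm_inner_column_sq (Ω : EuclideanSpace ℂ (a × b)) (f : EuclideanSpace ℂ a) :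
    ∑ j, ‖inner ℂ f (column Ω j)‖ ^ 2 =
      ∑ s, schmidtCoeff Ω s ^ 2 * ‖inner ℂ (schmidtLeft Ω s) f‖ ^ 2 := by
  have h1 : inner ℂ f (Matrix.toEuclideanLin (reducedDensity Ω) f) =
      ∑ s, ((schmidtCoeff Ω s ^ 2 * ‖inner ℂ (schmidtLeft Ω s) f‖ ^ 2 : ℝ) : ℂ) := by
    rw [toEuclideanLin_eq_diagOp (reducedDensity_isHermitian Ω),
      ← (schmidtLeft Ω).sum_inner_mul_inner]
    refine Finset.sum_congr rfl fun s _ => ?_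
    rw [schmidtLeft, inner_diagOp, schmidtCoeff_sq,
      ← inner_conj_symm f ((reducedDensity_isHermitian Ω).eigenvectorBasis s)]
    push_cast
    rw [← Complex.conj_mul']
    ring
  have h2 : inner ℂ f (Matrix.toEuclideanLin (reducedDensity Ω) f) =
      ∑ j, ((‖inner ℂ f (column Ω j)‖ ^ 2 : ℝ) : ℂ) := by
    have h3 : ∀ j, ((‖inner ℂ f (column Ω j)‖ ^ 2 : ℝ) : ℂ) =
        ∑ i, ∑ k, star (f i) * Ω (i, j) * (star (Ω (k, j)) * f k) := by
      intro j
      push_cast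
      rw [← Complex.mul_conj', inner_conj_symm, PiLp.inner_apply, PiLp.inner_apply,
        Finset.sum_mul_sum]
      refine Finset.sum_congr rfl fun i _ => Finset.sum_congr rfl fun k _ => ?_
      simp only [RCLike.inner_apply, column, Complex.star_def]
      ring
    simp_rw [h3]
    rw [PiLp.inner_apply, Finset.sum_comm]
    refine Finset.sum_congr rfl fun i _ => ?_
    rw [toEuclideanLin_apply_apply, RCLike.inner_apply, Finset.sum_mul, Finset.sum_comm]
    refine Finset.sum_congr rfl fun k _ => ?_
    simp only [reducedDensity, Matrix.mul_apply, Matrix.conjTranspose_apply, coeffMatrix,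
      Matrix.of_apply, Finset.sum_mul]
    refine Finset.sum_congr rfl fun j _ => ?_
    simp only [Complex.star_def]
    ring
  rw [h1] at h2
  exact_mod_cast h2.symm

/-- The Eckart–Young bound: the squared distance of `Ω` to a vector of Schmidt rank at most `D`
is at least the sum of all but the `D` largest squared Schmidt coefficients of `Ω`. -/
theorem sum_schmidtCoeff_tail_le {d : ℕ} (e : Fin d ≃ a) {Ω ψ : EuclideanSpace ℂ (a × b)}
    (he : Antitone fun i => schmidtCoeff Ω (e i) ^ 2) {D : ℕ} (hψ : schmidtRank ψ ≤ D) :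
    ∑ i : Fin d, (if (i : ℕ) < D then 0 else schmidtCoeff Ω (e i) ^ 2) ≤ ‖ψ - Ω‖ ^ 2 := by
  classical
  -- the columns of `ψ` lie in a space `W` of dimension at most `D`, so the distance is at least
  -- that of the columns of `Ω` from `W`
  set W : Submodule ℂ (EuclideanSpace ℂ a) :=
    LinearMap.range (Matrix.toEuclideanLin (coeffMatrix ψ)) with hW
  have hrank : Module.finrank ℂ W ≤ D := by
    rw [schmidtRank_eq_rank, Matrix.rank_eq_finrank_range_toLin _
      (PiLp.basisFun 2 ℂ a) (PiLp.basisFun 2 ℂ b)] at hψ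
    rwa [← Matrix.toLpLin_eq_toLin 2 2] at hψ
  set f := stdOrthonormalBasis ℂ W with hf
  have hf' : Orthonormal ℂ fun k => (f k : EuclideanSpace ℂ a) :=
    f.orthonormal.comp_linearIsometry W.subtypeₗᵢ
  have hmem : ∀ j, column ψ j ∈ W := fun j => by
    refine ⟨EuclideanSpace.single j 1, ?_⟩
    ext i
    change ∑ k, coeffMatrix ψ i k * (EuclideanSpace.single j (1 : ℂ) : EuclideanSpace ℂ b) k = _
    rw [Finset.sum_eq_single j]
    · simp [coeffMatrix, column]
    · intro k _ hk
      simp [hk]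
    · simp
  have hproj : ∀ x : EuclideanSpace ℂ a,
      ‖W.starProjection x‖ ^ 2 = ∑ k, ‖inner ℂ (f k : EuclideanSpace ℂ a) x‖ ^ 2 := by
    intro x
    have h1 : ‖W.starProjection x‖ = ‖W.orthogonalProjectionOnto x‖ := rfl
    rw [h1, ← f.sum_sq_norm_inner_right]
    refine Finset.sum_congr rfl fun k _ => ?_
    rw [Submodule.coe_inner, ← Submodule.starProjection_apply,
      ← Submodule.inner_starProjection_left_eq_right,
      Submodule.starProjection_eq_self_iff.mpr (f k).2]
  have hcol : ∀ j, ‖column Ω j‖ ^ 2 - ∑ k, ‖inner ℂ (f k : EuclideanSpace ℂ a) (column Ω j)‖ ^ 2 ≤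
      ‖column (ψ - Ω) j‖ ^ 2 := by
    intro j
    have h1 := Submodule.norm_sq_eq_add_norm_sq_starProjection (column (ψ - Ω) j) W
    have h2 := Submodule.norm_sq_eq_add_norm_sq_starProjection (column Ω j) W
    have h3 : column (ψ - Ω) j = column ψ j - column Ω j := rfl
    have h4 : Wᗮ.starProjection (column ψ j) = 0 := by
      rw [Submodule.starProjection_apply_eq_zero_iff]
      exact Submodule.le_orthogonal_orthogonal W (hmem j)
    have h5 : ‖Wᗮ.starProjection (column (ψ - Ω) j)‖ = ‖Wᗮ.starProjection (column Ω j)‖ := by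
      rw [h3, map_sub, h4, zero_sub, norm_neg]
    rw [h5] at h1
    rw [← hproj]
    nlinarith [sq_nonneg ‖W.starProjection (column (ψ - Ω) j)‖]
  set t : Fin d → ℝ := fun i => ∑ k, ‖inner ℂ (schmidtLeft Ω (e i)) (f k : EuclideanSpace ℂ a)‖ ^ 2
    with ht
  have ht1 : ∀ i, t i ≤ 1 := fun i => by
    have h1 := hf'.sum_inner_products_le (schmidtLeft Ω (e i)) (s := Finset.univ)
    rw [(schmidtLeft Ω).orthonormal.1, one_pow] at h1
    refine le_trans (le_of_eq ?_) h1
    exact Finset.sum_congr rfl fun k _ => by rw [norm_inner_symm]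
  have htD : ∑ i, t i ≤ D := by
    have h1 : ∑ i, t i = (Module.finrank ℂ W : ℝ) := by
      simp only [ht]
      rw [Finset.sum_comm]
      have h2 : ∀ k, ∑ i, ‖inner ℂ (schmidtLeft Ω (e i)) (f k : EuclideanSpace ℂ a)‖ ^ 2 = 1 := by
        intro k
        rw [e.sum_comp (fun s => ‖inner ℂ (schmidtLeft Ω s) (f k : EuclideanSpace ℂ a)‖ ^ 2),
          (schmidtLeft Ω).sum_sq_norm_inner_right, hf'.1 k, one_pow]
      simp [h2]
    rw [h1]
    exact_mod_cast hrank
  have hky := sum_mul_le_sum_of_antitone he (fun i => sq_nonneg _)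
    (fun i => Finset.sum_nonneg fun k _ => sq_nonneg _) ht1 htD
  have hsum := Finset.sum_le_sum fun (j : b) (_ : j ∈ Finset.univ) => hcol j
  rw [sum_norm_column_sq, Finset.sum_sub_distrib, sum_norm_column_sq, Finset.sum_comm] at hsum
  have hswap : ∑ k, ∑ j, ‖inner ℂ (f k : EuclideanSpace ℂ a) (column Ω j)‖ ^ 2 =
      ∑ i, schmidtCoeff Ω (e i) ^ 2 * t i := by
    simp_rw [sum_norm_inner_column_sq, ht, Finset.mul_sum]
    rw [Finset.sum_comm, ← e.sum_comp]
  have htot : ‖Ω‖ ^ 2 = ∑ i : Fin d, (if (i : ℕ) < D then schmidtCoeff Ω (e i) ^ 2 else 0) +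
      ∑ i : Fin d, (if (i : ℕ) < D then 0 else schmidtCoeff Ω (e i) ^ 2) := by
    rw [← sum_schmidtCoeff_sq, ← e.sum_comp, ← Finset.sum_add_distrib]
    refine Finset.sum_congr rfl fun i _ => ?_
    split_ifs <;> simp
  rw [hswap] at hsum
  linarith

theorem exists_equiv_antitone_schmidtCoeff (Ω : EuclideanSpace ℂ (a × b)) :
    ∃ e : Fin (Fintype.card a) ≃ a, Antitone fun i => schmidtCoeff Ω (e i) ^ 2 := by
  refine ⟨Fintype.equivOfCardEq (Fintype.card_fin _), ?_⟩
  have h : (fun i => schmidtCoeff Ω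
      ((Fintype.equivOfCardEq (Fintype.card_fin _) : Fin (Fintype.card a) ≃ a) i) ^ 2) =
      (reducedDensity_isHermitian Ω).eigenvalues₀ := by
    ext i
    rw [schmidtCoeff_sq, Matrix.IsHermitian.eigenvalues, Equiv.symm_apply_apply]
  rw [h]
  exact (reducedDensity_isHermitian Ω).eigenvalues₀_antitone

end Tail

/-! ### Entropy of a distribution with polynomially decaying tail -/

section Entropy

/-- Gibbs' inequality against the distribution `1 / ((i + 1) (i + 2))`. -/
theorem neg_sum_mul_log_le {d : ℕ} {p : Fin d → ℝ} (hp0 : ∀ i, 0 ≤ p i) (hp1 : ∑ i, p i = 1) :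
    -∑ i, p i * Real.log (p i) ≤
      2 * Real.log 2 * (1 + ∑ i, p i * (Nat.log 2 ((i : ℕ) + 1) : ℝ)) := by
  set w : Fin d → ℝ := fun i => 1 / (((i : ℝ) + 1) * ((i : ℝ) + 2)) with hw
  -- the sum telescopes
  have hw1 : ∑ i, w i ≤ 1 := by
    have h1 : ∀ n : ℕ, ∑ i ∈ Finset.range n, 1 / (((i : ℝ) + 1) * ((i : ℝ) + 2)) =
        1 - 1 / ((n : ℝ) + 1) := by
      intro n
      induction n with
      | zero => simp
      | succ n ih =>
        rw [Finset.sum_range_succ, ih]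
        push_cast
        field_simp
        ring
    rw [hw, Fin.sum_univ_eq_sum_range (fun i => 1 / (((i : ℝ) + 1) * ((i : ℝ) + 2))), h1]
    have : 0 ≤ 1 / ((d : ℝ) + 1) := by positivity
    linarith
  have hterm : ∀ i, -(p i * Real.log (p i)) ≤
      p i * (2 * Real.log 2 * (1 + (Nat.log 2 ((i : ℕ) + 1) : ℝ))) + (w i - p i) := by
    intro i
    have hwpos : 0 < w i := by positivity
    have hlogw : -Real.log (w i) ≤ 2 * Real.log 2 * (1 + (Nat.log 2 ((i : ℕ) + 1) : ℝ)) := by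
      have h2 : ((i : ℝ) + 2) ≤ 2 ^ (Nat.log 2 ((i : ℕ) + 1) + 1) := by
        have := Nat.lt_pow_succ_log_self (b := 2) (by norm_num) ((i : ℕ) + 1)
        exact_mod_cast (by omega : (i : ℕ) + 2 ≤ 2 ^ (Nat.log 2 ((i : ℕ) + 1) + 1))
      have h3 := Real.log_le_log (by positivity) h2
      have h4 : Real.log ((i : ℝ) + 1) ≤ Real.log ((i : ℝ) + 2) :=
        Real.log_le_log (by positivity) (by linarith)
      rw [Real.log_pow] at h3
      push_cast at h3
      rw [hw]
      simp only
      rw [one_div, Real.log_inv, neg_neg, Real.log_mul (by positivity) (by positivity)]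
      linarith
    have h5 := mul_le_mul_of_nonneg_left hlogw (hp0 i)
    rcases (hp0 i).eq_or_lt with h0 | h0
    · rw [← h0]
      simpa using hwpos.le
    · have h6 := Real.log_le_sub_one_of_pos (div_pos hwpos h0)
      rw [Real.log_div hwpos.ne' h0.ne'] at h6
      have h7 := mul_le_mul_of_nonneg_left h6 h0.le
      have h8 : p i * (w i / p i - 1) = w i - p i := by field_simp
      rw [h8] at h7
      linarith
  rw [← Finset.sum_neg_distrib]
  refine (Finset.sum_le_sum fun i _ => hterm i).trans ?_
  rw [Finset.sum_add_distrib, Finset.sum_sub_distrib, hp1]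
  have h9 : ∑ i, p i * (2 * Real.log 2 * (1 + (Nat.log 2 ((i : ℕ) + 1) : ℝ))) =
      2 * Real.log 2 * (1 + ∑ i, p i * (Nat.log 2 ((i : ℕ) + 1) : ℝ)) := by
    conv_rhs => rw [← hp1, ← Finset.sum_add_distrib, Finset.mul_sum]
    exact Finset.sum_congr rfl fun i _ => by ring
  rw [h9]
  linarith

/-- The mean of the dyadic scale `⌊log₂ (i + 1)⌋`: up to the scale `j` where the tail bound becomes
nontrivial it contributes at most `j`, and the scales above `j` a geometric series. -/
theorem sum_mul_log_le {d : ℕ} {p : Fin d → ℝ} (hp0 : ∀ i, 0 ≤ p i) (hp1 : ∑ i, p i = 1)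
    {ρ : ℝ} (hρ0 : 0 ≤ ρ) (hρ1 : ρ < 1) {j : ℕ}
    (htail : ∀ m : ℕ, ∑ i : Fin d, (if (i : ℕ) < 2 ^ (j + m) then 0 else p i) ≤ ρ ^ m) :
    ∑ i, p i * (Nat.log 2 ((i : ℕ) + 1) : ℝ) ≤ j + (1 - ρ)⁻¹ := by
  have hcount : ∀ i : Fin d, (Nat.log 2 ((i : ℕ) + 1) : ℝ) ≤
      j + ∑ m ∈ Finset.range d, (if (i : ℕ) < 2 ^ (j + m) then (0 : ℝ) else 1) := by
    intro i
    set l := Nat.log 2 ((i : ℕ) + 1) with hl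
    have hl1 : 2 ^ l ≤ (i : ℕ) + 1 := Nat.pow_log_le_self 2 (by omega)
    have hl2 : l < 2 ^ l := Nat.lt_two_pow_self
    have hsub : Finset.range (l - j) ⊆ Finset.range d := by
      intro m hm
      have := i.2
      rw [Finset.mem_range] at hm ⊢
      omega
    have h1 : ((l - j : ℕ) : ℝ) ≤
        ∑ m ∈ Finset.range d, (if (i : ℕ) < 2 ^ (j + m) then (0 : ℝ) else 1) := by
      have h2 : ∀ m ∈ Finset.range (l - j), (if (i : ℕ) < 2 ^ (j + m) then (0 : ℝ) else 1) = 1 := by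
        intro m hm
        rw [Finset.mem_range] at hm
        have h3 : 2 ^ (j + m) < 2 ^ l := Nat.pow_lt_pow_right (by norm_num) (by omega)
        exact if_neg (by omega)
      have h4 := Finset.sum_le_sum_of_subset_of_nonneg
        (f := fun m => if (i : ℕ) < 2 ^ (j + m) then (0 : ℝ) else 1) hsub
        fun m _ _ => by split_ifs <;> norm_num
      rw [Finset.sum_congr rfl h2] at h4
      simpa using h4
    have h3 : (l : ℝ) ≤ j + (l - j : ℕ) := by exact_mod_cast (by omega : l ≤ j + (l - j))
    linarith
  calc _ ≤ ∑ i, p i * (j + ∑ m ∈ Finset.range d, (if (i : ℕ) < 2 ^ (j + m) then (0 : ℝ) else 1)) :=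
        Finset.sum_le_sum fun i _ => mul_le_mul_of_nonneg_left (hcount i) (hp0 i)
    _ = j + ∑ m ∈ Finset.range d, ∑ i : Fin d, (if (i : ℕ) < 2 ^ (j + m) then 0 else p i) := by
        simp_rw [mul_add]
        rw [Finset.sum_add_distrib, ← Finset.sum_mul, hp1, one_mul]
        simp_rw [Finset.mul_sum, mul_ite, mul_zero, mul_one]
        rw [Finset.sum_comm]
    _ ≤ j + ∑ m ∈ Finset.range d, ρ ^ m := by
        gcongr with m _
        exact htail m
    _ ≤ _ := by
        gcongr
        rw [← tsum_geometric_of_lt_one hρ0 hρ1]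
        exact (summable_geometric_of_lt_one hρ0 hρ1).sum_le_tsum _ fun m _ => pow_nonneg hρ0 m

theorem two_rpow_neg_mem {κ : ℝ} (hκ : 0 < κ) :
    0 < (2 : ℝ) ^ (-2 * κ) ∧ (2 : ℝ) ^ (-2 * κ) < 1 :=
  ⟨by positivity, Real.rpow_lt_one_of_one_lt_of_neg (by norm_num) (by linarith)⟩

/-- The entropy of a distribution with tails at most `C ^ 2 D ^ (-2 κ)`: up to constants, the
number of dyadic scales with trivial tail bound is `log C / (κ log 2)`. -/
theorem entropy_le_of_tail_le {d : ℕ} {p : Fin d → ℝ} (hp0 : ∀ i, 0 ≤ p i) (hp1 : ∑ i, p i = 1)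
    {C κ : ℝ} (hC : 1 ≤ C) (hκ : 0 < κ)
    (htail : ∀ D : ℕ, 1 ≤ D →
      ∑ i : Fin d, (if (i : ℕ) < D then 0 else p i) ≤ (C * (D : ℝ) ^ (-κ)) ^ 2) :
    -∑ i, p i * Real.log (p i) ≤ entropyConst₁ κ * Real.log C + entropyConst₂ κ := by
  obtain ⟨hρ0, hρ1⟩ := two_rpow_neg_mem hκ
  set ρ := (2 : ℝ) ^ (-2 * κ) with hρ
  have hl2 : 0 < Real.log 2 := Real.log_pos (by norm_num)
  have hlC : 0 ≤ Real.log C := Real.log_nonneg hC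
  set j := ⌈Real.log C / (κ * Real.log 2)⌉₊ with hj
  have hj1 : Real.log C / (κ * Real.log 2) ≤ j := Nat.le_ceil _
  have hj2 : (j : ℝ) < Real.log C / (κ * Real.log 2) + 1 := Nat.ceil_lt_add_one (by positivity)
  -- `j` is chosen so that `C * 2 ^ (-κ j) ≤ 1`
  have htail' : ∀ m : ℕ, ∑ i : Fin d, (if (i : ℕ) < 2 ^ (j + m) then 0 else p i) ≤ ρ ^ m := by
    intro m
    refine (htail (2 ^ (j + m)) Nat.one_le_two_pow).trans ?_
    have hpow : ((2 ^ (j + m) : ℕ) : ℝ) ^ (-κ) =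
        Real.exp (-(κ * Real.log 2 * j)) * Real.exp (-(κ * Real.log 2 * m)) := by
      rw [Real.rpow_def_of_pos (by positivity), ← Real.exp_add]
      push_cast
      rw [Real.log_pow]
      push_cast
      ring_nf
    have hρm : ρ ^ m = Real.exp (-(κ * Real.log 2 * m)) ^ 2 := by
      rw [hρ, Real.rpow_def_of_pos (by norm_num), ← Real.exp_nat_mul, ← Real.exp_nat_mul]
      push_cast
      ring_nf
    have hCj : C * Real.exp (-(κ * Real.log 2 * j)) ≤ 1 := by
      rw [Real.exp_neg, ← div_eq_mul_inv, div_le_one (Real.exp_pos _)]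
      rw [div_le_iff₀ (by positivity)] at hj1
      calc C = Real.exp (Real.log C) := (Real.exp_log (by linarith)).symm
        _ ≤ _ := Real.exp_le_exp.mpr (by linarith)
    rw [hpow, hρm, ← mul_assoc]
    have h0 : 0 ≤ C := by linarith
    gcongr
    exact mul_le_of_le_one_left (Real.exp_pos _).le hCj
  have h1 := neg_sum_mul_log_le hp0 hp1
  have h2 := sum_mul_log_le hp0 hp1 hρ0.le hρ1 htail'
  have hd0 : 0 < 1 - ρ := by linarith
  have h3 : 2 * Real.log 2 * (Real.log C / (κ * Real.log 2)) = 2 / κ * Real.log C := by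
    field_simp
  have h4 : 2 / κ ≤ entropyConst₁ κ := by
    rw [entropyConst₁, ← hρ, div_le_div_iff₀ hκ (by positivity)]
    nlinarith [mul_pos hκ hρ0]
  have h5 : 2 * Real.log 2 * (2 + (1 - ρ)⁻¹) ≤ entropyConst₂ κ := by
    rw [entropyConst₂, ← hρ, div_eq_mul_inv]
    have hu : 1 ≤ (1 - ρ)⁻¹ := (one_le_inv₀ hd0).mpr (by linarith)
    have h6 : 2 * (2 + (1 - ρ)⁻¹) ≤ (6 + 2 * κ) * ((1 - ρ) ^ 2)⁻¹ := by
      rw [← inv_pow]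
      have : 0 ≤ 2 * κ * (1 - ρ)⁻¹ ^ 2 := by positivity
      nlinarith
    nlinarith
  have h7 : 2 / κ * Real.log C ≤ entropyConst₁ κ * Real.log C := by gcongr
  have h8 : 2 * Real.log 2 * (1 + ∑ i, p i * (Nat.log 2 ((i : ℕ) + 1) : ℝ)) ≤
      2 * Real.log 2 * (1 + (Real.log C / (κ * Real.log 2) + 1 + (1 - ρ)⁻¹)) := by
    gcongr
    linarith
  linarith

theorem entanglementEntropy_le {a b : Type*} [Fintype a] [DecidableEq a] [Fintype b]
    {Ω : EuclideanSpace ℂ (a × b)} (hΩ : ‖Ω‖ = 1) {C κ : ℝ} (hC : 1 ≤ C) (hκ : 0 < κ)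
    (happrox : ∀ D : ℕ, 1 ≤ D → ∃ ψ : EuclideanSpace ℂ (a × b), ‖ψ‖ = 1 ∧ schmidtRank ψ ≤ D ∧
      ‖ψ - Ω‖ ≤ C * (D : ℝ) ^ (-κ)) :
    entanglementEntropy Ω ≤ entropyConst₁ κ * Real.log C + entropyConst₂ κ := by
  obtain ⟨e, he⟩ := exists_equiv_antitone_schmidtCoeff Ω
  rw [entanglementEntropy, ← e.sum_comp]
  refine entropy_le_of_tail_le (p := fun i => schmidtCoeff Ω (e i) ^ 2) (fun i => sq_nonneg _) ?_
    hC hκ fun D hD => ?_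
  · rw [e.sum_comp (fun s => schmidtCoeff Ω s ^ 2), sum_schmidtCoeff_sq, hΩ, one_pow]
  · obtain ⟨ψ, -, hψ, hle⟩ := happrox D hD
    refine (sum_schmidtCoeff_tail_le e he hψ).trans ?_
    gcongr

end Entropy

end AreaLaw

theorem mainTheorem6 {a b : Type*} [Fintype a] [DecidableEq a] [Fintype b] [DecidableEq b]
    (HA : Matrix a a ℂ) (HB : Matrix b b ℂ) (V : ℝ → Matrix (a × b) (a × b) ℂ)
    (Ω : ℝ → EuclideanSpace ℂ (a × b)) (Δ g c₀ S₀ : ℝ) (hΔ : 0 < Δ) (hg : 0 < g)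
    (hpath : AreaLaw.IsBoundaryAdiabaticPath HA HB V Ω Δ g c₀)
    (hS₀ : AreaLaw.renyiInfEntropy (Ω 0) = S₀) :
    (∀ D : ℕ, 1 ≤ D → ∃ ψ : EuclideanSpace ℂ (a × b), ‖ψ‖ = 1 ∧ AreaLaw.schmidtRank ψ ≤ D ∧
      ‖ψ - Ω 1‖ ≤ AreaLaw.errorConst Δ g c₀ S₀ * (D : ℝ) ^ (-AreaLaw.kappa Δ g)) ∧
    AreaLaw.entanglementEntropy (Ω 1) ≤
      AreaLaw.entropyConst₁ (AreaLaw.kappa Δ g) * Real.log (AreaLaw.errorConst Δ g c₀ S₀) +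
        AreaLaw.entropyConst₂ (AreaLaw.kappa Δ g) := by
  subst hS₀
  have happrox := fun (D : ℕ) (hD : 1 ≤ D) => hpath.exists_schmidtRank_le hΔ hg hD
  refine ⟨happrox, AreaLaw.entanglementEntropy_le (hpath.norm_eq_one (by simp)) ?_
    (AreaLaw.kappa_pos hΔ hg) happrox⟩
  have hS := AreaLaw.renyiInfEntropy_nonneg (hpath.norm_eq_one (ν := 0) (by simp))
  refine le_trans ?_ (AreaLaw.twelve_mul_exp_le_errorConst hΔ hg hpath.nonneg hS)
  have hκ := AreaLaw.kappa_pos hΔ hg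
  have hx : 0 ≤ c₀ * g / Δ := div_nonneg hpath.nonneg hΔ.le
  have : 1 ≤ Real.exp (AreaLaw.renyiInfEntropy (Ω 0) / 2 + 2 * AreaLaw.kappa Δ g *
      (g / Δ * (AreaLaw.renyiInfEntropy (Ω 0) + 12 + 6 * (c₀ * g / Δ) +
        21 * (c₀ * g / Δ) ^ 2))) := Real.one_le_exp (by positivity)
  linarith
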